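/- Logarithms are to base $2$ and graphs are finite and simple. For a graph $G$, $F\subseteq E(G)$ and $U\subseteq V(G)$, let $N_{G-F}(U)$ be the set of vertices outside $U$ that are joined to a vertex of $U$ by an edge of $G$ not in $F$. An $n$-vertex graph $G$ is an $(\varepsilon,s)$-expander if $|N_{G-F}(U)|\ge \varepsilon|U|/(\log n)^2$ for all $U\subseteq V(G)$ and $F\subseteq E(G)$ with $1\le |U|\le \frac23 n$ and $|F|\le s|U|$. A set $V\subseteq V(G)$ is $D$-connecting in an $n$-vertex graph $G$ if for every sequence $x_1,\dots,x_r,y_1,\dots,y_r$ of (not necessarily distinct) vertices of $V(G)\setminus V$ such that each vertex of $V$ has at most $D$ neighbours, counted with multiplicity, in the multiset $\{x_1,\dots,x_r,y_1,\dots,y_r\}$, there are paths $P_1,\dots,P_r$ in $G$ such that $P_i$ joins $x_i$ and $y_i$, has length at most $(\log n)^6$ and has all its internal vertices in $V$, and no two of the paths share an internal vertex (if $x_i=y_i$, then $P_i$ is the trivial path of length $0$). **Lemma.** There is a function $f:\mathbb N\to\mathbb R$ with $f(n)\to0$ as $n\to\infty$ such that the following holds. Let $G$ be an $n$-vertex $(\varepsilon,s)$-expander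 with minimum degree $\delta$ and maximum degree $\Delta$, where $2^{-90}<\varepsilon<1$ and $s\ge p^{-4}(\log n)^{30}$ for some $p$ with $\frac{100\log n}{\delta}\le p\le 1$. Let $V$ be a $p$-random subset of $V(G)$, that is, each vertex is included in $V$ independently with probability $p$. Then, with probability at least $1-f(n)$, the set $V$ is $D$-connecting in $G$ for $$D=\frac{p^9 s\,\delta}{\Delta(\log n)^{73}}.$$ -/

import Mathlib

namespace SublinearExpander

open SimpleGraph

variable {V : Type*}

/-- `N_G(U)`: the vertices outside `U` that have a neighbour in `U`. -/
def extNeighbors (G : SimpleGraph V) (U : Finset V) : Set V :=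
  {v | v ∉ U ∧ ∃ u ∈ U, G.Adj u v}

/-- `(ε, s)`-expanders on `n = |V|` vertices; logarithms are to base 2. -/
def IsExpander [Fintype V] (G : SimpleGraph V) (ε s : ℝ) : Prop :=
  ∀ (U : Finset V) (F : Finset (Sym2 V)), (F : Set (Sym2 V)) ⊆ G.edgeSet →
    1 ≤ U.card → (U.card : ℝ) ≤ 2 / 3 * (Fintype.card V : ℝ) →
    (F.card : ℝ) ≤ s * (U.card : ℝ) →
    ε * (U.card : ℝ) / (Real.logb 2 (Fintype.card V : ℝ)) ^ 2 ≤
      ((extNeighbors (G.deleteEdges (F : Set (Sym2 V))) U).ncard : ℝ)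

/-- The vertices of a path other than its two endpoints. -/
def internalVertices {G : SimpleGraph V} {u v : V} (P : G.Walk u v) : Set V :=
  {w | w ∈ P.support ∧ w ≠ u ∧ w ≠ v}

/-- `S` is `D`-connecting in `G`. Indices count with multiplicity. Since the internal vertices lie
in `S` and the endpoints outside `S`, pairwise disjoint interiors also avoid all endpoints. For
`x i = y i` the only path is the trivial one, so such pairs impose no requirement. -/
def IsConnecting [Fintype V] (G : SimpleGraph V) (D : ℝ) (S : Set V) : Prop :=
  ∀ (r : ℕ) (x y : Fin r → V), (∀ i, x i ∉ S) → (∀ i, y i ∉ S) →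
    (∀ v ∈ S, (({i | G.Adj v (x i)}.ncard + {i | G.Adj v (y i)}.ncard : ℕ) : ℝ) ≤ D) →
    ∃ P : ∀ i, G.Walk (x i) (y i),
      (∀ i, (P i).IsPath ∧ internalVertices (P i) ⊆ S ∧
        ((P i).length : ℝ) ≤ (Real.logb 2 (Fintype.card V : ℝ)) ^ 6) ∧
      ∀ i j, i ≠ j → Disjoint (internalVertices (P i)) (internalVertices (P j))

end SublinearExpander

/-! Haxell's theorem (`exists_disjoint_representatives`), applied to the interiors of admissible
paths, reduces disjointness to one path at a time: for every nonempty set `I` of indices and every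
set `W` of at most `2 (log n)^6 |I|` vertices, some `i ∈ I` must have a short path from `x i` to `y
i` through the random set that avoids `W`.

Choose `q` with `(1 - q)^(N+1) = 1 - p` and regard the random set as `S ∪ T`, where `S` consists of
`N` independent layers of density `q` and `T` is one more layer. The neighbourhood of each endpoint,
minus `W`, is grown through `S`. One layer enlarges a set `B` by a factor `1 + ε / (8 (log n)^2)`:
the expander has a sparse subgraph of many edges leaving `B` with bounded degrees on both sides
(`IsExpander.exists_sparse_subgraph`), so an exponential lower tail bound (`bernProb_lt_le`) applies
to the neighbours of the sampled part of `B`, with an exponent proportional to `|B|`.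

A single neighbourhood may be too small compared with `W` for a union bound over all `W`. A set `X`
of endpoints is therefore treated as a whole. The condition on `D` and the degrees into `S` give `X`
at least `|X| Q / 2` neighbours outside `W`, where `D Q = p δ / 8`, and this makes the failure
probability less than `n^(-2(|X| + |W| + 1))`. Summing over all pairs `(X, W)` costs only a
constant. Once the union has grown to `3n/5` vertices, one half of `X` still covers at least the
initial threshold. Growing and halving about `log n` times leaves a single endpoint whose own set
reaches `3n/5` (`bernProb_forall_iterate_grow_lt_le`).

Applied to the endpoints that fail to grow, this shows that fewer than half of the indices in `I`
fail for `x`, and likewise for `y`. Some index is good on both sides; its two sets share at least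
`n/5` vertices, and `T` meets this intersection (`bernProb_disjoint_le`), which joins the two walks.
-/

namespace SublinearExpander

open Finset

/-! ### Random subsets of a finite set -/

section Bernoulli

variable {α : Type*}

/-- The expectation of `f` at a random subset of `B` that contains each element of `B`
independently with probability `q`. -/
def bernExp (q : ℝ) (B : Finset α) (f : Finset α → ℝ) : ℝ :=
  ∑ S ∈ B.powerset, q ^ #S * (1 - q) ^ (#B - #S) * f S

lemma bernExp_empty (q : ℝ) (f : Finset α → ℝ) : bernExp q ∅ f = f ∅ := by
  simp [bernExp]

lemma bernExp_mono {q : ℝ} (h0 : 0 ≤ q) (h1 : q ≤ 1) {B : Finset α} {f g : Finset α → ℝ}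
    (h : ∀ S ⊆ B, f S ≤ g S) : bernExp q B f ≤ bernExp q B g := by
  refine Finset.sum_le_sum fun S hS => ?_
  have : 0 ≤ 1 - q := by linarith
  exact mul_le_mul_of_nonneg_left (h S (Finset.mem_powerset.1 hS)) (by positivity)

lemma bernExp_congr {q : ℝ} {B : Finset α} {f g : Finset α → ℝ}
    (h : ∀ S ⊆ B, f S = g S) : bernExp q B f = bernExp q B g :=
  Finset.sum_congr rfl fun S hS => by rw [h S (Finset.mem_powerset.1 hS)]

lemma bernExp_add (q : ℝ) (B : Finset α) (f g : Finset α → ℝ) :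
    bernExp q B (fun S => f S + g S) = bernExp q B f + bernExp q B g := by
  simp [bernExp, mul_add, Finset.sum_add_distrib]

lemma bernExp_mul_left (q : ℝ) (B : Finset α) (c : ℝ) (f : Finset α → ℝ) :
    bernExp q B (fun S => c * f S) = c * bernExp q B f := by
  simp only [bernExp, Finset.mul_sum]
  exact Finset.sum_congr rfl fun S _ => by ring

lemma bernExp_sum {ι : Type*} (q : ℝ) (B : Finset α) (t : Finset ι) (f : ι → Finset α → ℝ) :
    bernExp q B (fun S => ∑ i ∈ t, f i S) = ∑ i ∈ t, bernExp q B (f i) := by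
  simp only [bernExp, Finset.mul_sum]
  exact Finset.sum_comm

section Probability

variable [Fintype α]

open Classical in
/-- The probability that a random set of density `q` has the property `P`. -/
noncomputable def bernProb (q : ℝ) (P : Finset α → Prop) : ℝ :=
  bernExp q Finset.univ (fun S => if P S then 1 else 0)

lemma bernProb_mono {q : ℝ} (h0 : 0 ≤ q) (h1 : q ≤ 1) {P R : Finset α → Prop}
    (h : ∀ S, P S → R S) : bernProb q P ≤ bernProb q R := by
  refine bernExp_mono h0 h1 fun S _ => ?_
  by_cases hP : P S
  · simp [hP, h S hP]
  · by_cases hR : R S <;> simp [hP, hR]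

lemma bernProb_or_le {q : ℝ} (h0 : 0 ≤ q) (h1 : q ≤ 1) (P R : Finset α → Prop) :
    bernProb q (fun S => P S ∨ R S) ≤ bernProb q P + bernProb q R := by
  unfold bernProb
  rw [← bernExp_add]
  refine bernExp_mono h0 h1 fun S _ => ?_
  by_cases hP : P S <;> by_cases hR : R S <;> simp [hP, hR]

lemma bernProb_exists_le {ι : Type*} {q : ℝ} (h0 : 0 ≤ q) (h1 : q ≤ 1) (t : Finset ι)
    (P : ι → Finset α → Prop) :
    bernProb q (fun S => ∃ i ∈ t, P i S) ≤ ∑ i ∈ t, bernProb q (P i) := by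
  classical
  unfold bernProb
  rw [← bernExp_sum]
  refine bernExp_mono h0 h1 fun S _ => ?_
  by_cases h : ∃ i ∈ t, P i S
  · obtain ⟨i, hi, hP⟩ := h
    rw [if_pos ⟨i, hi, hP⟩]
    refine le_trans ?_ (Finset.single_le_sum (f := fun i => if P i S then (1 : ℝ) else 0)
      (fun j _ => by positivity) hi)
    simp [hP]
  · rw [if_neg h]
    exact Finset.sum_nonneg fun j _ => by positivity

end Probability

variable [DecidableEq α]

lemma bernExp_insert (q : ℝ) {a : α} {B : Finset α} (ha : a ∉ B) (f : Finset α → ℝ) :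
    bernExp q (insert a B) f =
      (1 - q) * bernExp q B f + q * bernExp q B (fun S => f (insert a S)) := by
  unfold bernExp
  rw [Finset.sum_powerset_insert ha, Finset.mul_sum, Finset.mul_sum]
  congr 1
  · refine Finset.sum_congr rfl fun S hS => ?_
    have hS := Finset.mem_powerset.1 hS
    have := Finset.card_le_card hS
    rw [Finset.card_insert_of_notMem ha, Nat.sub_add_comm this, pow_succ]
    ring
  · refine Finset.sum_congr rfl fun S hS => ?_
    have hS := Finset.mem_powerset.1 hS
    rw [Finset.card_insert_of_notMem ha, Finset.card_insert_of_notMem (fun h => ha (hS h)),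
      Nat.add_sub_add_right, pow_succ]
    ring

lemma bernExp_const (q : ℝ) (B : Finset α) (c : ℝ) : bernExp q B (fun _ => c) = c := by
  induction B using Finset.induction_on with
  | empty => exact bernExp_empty _ _
  | insert a B ha ih => rw [bernExp_insert q ha, ih]; ring

/-- The union of independent random sets with densities `a` and `b` is a random set of density
`1 - (1 - a) * (1 - b)`. -/
lemma bernExp_union (a b : ℝ) (B : Finset α) (f : Finset α → ℝ) :
    bernExp (1 - (1 - a) * (1 - b)) B f =
      bernExp a B (fun S => bernExp b B (fun T => f (S ∪ T))) := by
  induction B using Finset.induction_on generalizing f with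
  | empty => simp [bernExp_empty]
  | insert c B hc ih =>
    simp only [bernExp_insert _ hc, bernExp_add, bernExp_mul_left, Finset.insert_union,
      Finset.union_insert, Finset.insert_idem]
    rw [ih, ih]
    ring

lemma bernExp_disjoint (q : ℝ) {A B : Finset α} (h : A ⊆ B) :
    bernExp q B (fun S => if Disjoint A S then 1 else 0) = (1 - q) ^ #A := by
  induction B using Finset.induction_on generalizing A with
  | empty => obtain rfl := Finset.subset_empty.1 h; simp [bernExp_empty]
  | insert c B hc ih =>
    rw [bernExp_insert _ hc]
    by_cases hA : c ∈ A
    · have e1 : bernExp q B (fun S => if Disjoint A (insert c S) then (1 : ℝ) else 0) = 0 := by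
        refine (bernExp_congr fun S _ => if_neg ?_).trans (bernExp_const q B 0)
        simp [Finset.disjoint_insert_right, hA]
      have e2 : bernExp q B (fun S => if Disjoint A S then (1 : ℝ) else 0) =
          bernExp q B (fun S => if Disjoint (A.erase c) S then (1 : ℝ) else 0) := by
        refine bernExp_congr fun S hS => ?_
        have hcS : c ∉ S := fun h => hc (hS h)
        have : Disjoint A S ↔ Disjoint (A.erase c) S := by
          conv_lhs => rw [← Finset.insert_erase hA, Finset.disjoint_insert_left]
          simp [hcS]
        simp only [this]
      rw [e1, e2, ih (by rwa [← Finset.subset_insert_iff]), ← Finset.card_erase_add_one hA,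
        pow_succ]
      ring
    · have hAB : A ⊆ B := (Finset.subset_insert_iff_of_notMem hA).1 h
      simp only [Finset.disjoint_insert_right, hA, not_false_eq_true, true_and]
      rw [ih hAB]
      ring

lemma exp_neg_le_one_sub_half {y : ℝ} (h0 : 0 ≤ y) (h1 : y ≤ 1) : Real.exp (-y) ≤ 1 - y / 2 := by
  have h3 := Real.quadratic_le_exp_of_nonneg h0
  rw [Real.exp_neg, inv_le_comm₀ (Real.exp_pos _) (by linarith)]
  refine le_trans ?_ h3
  rw [inv_le_iff_one_le_mul₀ (by linarith)]
  nlinarith [mul_nonneg h0 (sub_nonneg.2 h1), mul_nonneg h0 (mul_nonneg h0 (sub_nonneg.2 h1))]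

/-- An exponential moment bound for monotone set functions with increments at most `1`. -/
lemma bernExp_exp_neg_le {q : ℝ} (h0 : 0 ≤ q) (h1 : q ≤ 1) (B : Finset α) (f : Finset α → ℝ)
    (hmono : ∀ S a, f S ≤ f (insert a S)) (hinc : ∀ S a, f (insert a S) ≤ f S + 1) :
    bernExp q B (fun S => Real.exp (-f S)) ≤ Real.exp (-bernExp (q / 2) B f) := by
  induction B using Finset.induction_on generalizing f with
  | empty => simp [bernExp_empty]
  | insert c B hc ih =>
    rw [bernExp_insert _ hc, bernExp_insert _ hc]
    -- Averaging `c` out at density `q / 2` keeps monotonicity and the increment bound. What remains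
    -- is `1 - q + q * exp (-m) ≤ exp (-(q * m / 2))` for an increment `m` in `[0, 1]`. It follows
    -- from `exp (-m) ≤ 1 - m / 2`, which is where the density is halved.
    set g : Finset α → ℝ := fun S => (1 - q / 2) * f S + q / 2 * f (insert c S) with hg
    have key : bernExp q B (fun S => Real.exp (-g S)) ≤ Real.exp (-bernExp (q / 2) B g) := by
      apply ih
      · intro S a
        have e1 := hmono S a
        have e2 := hmono (insert c S) a
        rw [Finset.insert_comm] at e2
        simp only [hg]
        nlinarith
      · intro S a
        have e1 := hinc S a
        have e2 := hinc (insert c S) a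
        rw [Finset.insert_comm] at e2
        simp only [hg]
        nlinarith
    rw [show bernExp (q / 2) B g = (1 - q / 2) * bernExp (q / 2) B f +
      q / 2 * bernExp (q / 2) B (fun S => f (insert c S)) by
        rw [hg, bernExp_add, bernExp_mul_left, bernExp_mul_left]] at key
    refine le_trans ?_ key
    rw [← bernExp_mul_left, ← bernExp_mul_left, ← bernExp_add]
    refine bernExp_mono h0 h1 fun S _ => ?_
    obtain ⟨m, hm⟩ : ∃ m, f (insert c S) = f S + m := ⟨_, (add_sub_cancel _ _).symm⟩
    have m0 : 0 ≤ m := by have := hmono S c; linarith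
    have m1 : m ≤ 1 := by have := hinc S c; linarith
    have hgS : g S = f S + q / 2 * m := by simp only [hg, hm]; ring
    rw [hgS, hm, neg_add, neg_add, Real.exp_add, Real.exp_add]
    have hm2 := exp_neg_le_one_sub_half m0 m1
    have hq2 : 1 - q / 2 * m ≤ Real.exp (-(q / 2 * m)) := by
      have := Real.add_one_le_exp (-(q / 2 * m)); linarith
    have : (1 - q) * Real.exp (-f S) + q * (Real.exp (-f S) * Real.exp (-m)) =
      Real.exp (-f S) * (1 - q + q * Real.exp (-m)) := by ring
    rw [this]
    refine mul_le_mul_of_nonneg_left (le_trans ?_ hq2) (Real.exp_pos _).le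
    nlinarith

variable [Fintype α]

lemma bernProb_false (q : ℝ) {P : Finset α → Prop} (h : ∀ S, ¬ P S) : bernProb q P = 0 := by
  unfold bernProb
  simp only [h, if_false]
  exact bernExp_const _ _ _

lemma bernProb_not (q : ℝ) (P : Finset α → Prop) :
    bernProb q (fun S => ¬ P S) = 1 - bernProb q P := by
  have : bernProb q (fun S => ¬ P S) + bernProb q P = 1 := by
    unfold bernProb
    rw [← bernExp_add]
    refine (bernExp_congr fun S _ => ?_).trans (bernExp_const q _ 1)
    by_cases hP : P S <;> simp [hP]
  linarith

lemma bernProb_le_one {q : ℝ} (h0 : 0 ≤ q) (h1 : q ≤ 1) (P : Finset α → Prop) :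
    bernProb q P ≤ 1 := by
  refine (bernExp_mono h0 h1 fun S _ => ?_).trans (bernExp_const q (univ : Finset α) 1).le
  split_ifs <;> norm_num

/-- If a property of `S ∪ T` can fail only when `S` has the property `P`, or when `T` has, for a
given `S` without the property `P`, a property of small probability, then it fails rarely. -/
lemma bernProb_union_le {a b c : ℝ} (ha0 : 0 ≤ a) (ha1 : a ≤ 1) (hb0 : 0 ≤ b) (hb1 : b ≤ 1)
    (hc : 0 ≤ c) (P R : Finset α → Prop) (Q : Finset α → Finset α → Prop)
    (hR : ∀ S T, R (S ∪ T) → P S ∨ Q S T) (hQ : ∀ S, ¬ P S → bernProb b (Q S) ≤ c) :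
    bernProb (1 - (1 - a) * (1 - b)) R ≤ bernProb a P + c := by
  classical
  unfold bernProb
  rw [bernExp_union, ← bernExp_const a (univ : Finset α) c, ← bernExp_add]
  refine bernExp_mono ha0 ha1 fun S _ => ?_
  by_cases hP : P S
  · rw [if_pos hP]
    have := bernProb_le_one hb0 hb1 (fun T => R (S ∪ T))
    unfold bernProb at this
    linarith
  · rw [if_neg hP, zero_add]
    refine le_trans ?_ (hQ S hP)
    exact bernProb_mono hb0 hb1 fun T hT => (hR S T hT).resolve_left hP

/-- A lower tail bound for monotone set functions with increments at most `1`. -/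
lemma bernProb_lt_le {q t : ℝ} (h0 : 0 ≤ q) (h1 : q ≤ 1) (f : Finset α → ℝ)
    (hmono : ∀ S a, f S ≤ f (insert a S)) (hinc : ∀ S a, f (insert a S) ≤ f S + 1) :
    bernProb q (fun S => f S < t) ≤ Real.exp (t - bernExp (q / 2) univ f) := by
  rw [sub_eq_add_neg, Real.exp_add]
  refine le_trans ?_ (mul_le_mul_of_nonneg_left (bernExp_exp_neg_le h0 h1 univ f hmono hinc)
    (Real.exp_pos _).le)
  rw [← bernExp_mul_left]
  refine bernExp_mono h0 h1 fun S _ => ?_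
  rw [← Real.exp_add]
  split_ifs with h
  · exact Real.one_le_exp (by linarith)
  · positivity

end Bernoulli

/-! ### Disjoint representatives for families of small sets -/

section Representatives

variable {ι α : Type*} [DecidableEq ι]

/-- `M` selects pairwise disjoint members of the families `E i` with `i ∈ J`. -/
def IsSystem (E : ι → Set (Finset α)) (J : Finset ι) (M : ι → Finset α) : Prop :=
  (∀ j ∈ J, M j ∈ E j) ∧ ∀ i ∈ J, ∀ j ∈ J, i ≠ j → Disjoint (M i) (M j)

lemma IsSystem.update {E : ι → Set (Finset α)} {J : Finset ι} {M : ι → Finset α}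
    (hM : IsSystem E J M) {c : ι} {e : Finset α} (he : e ∈ E c)
    (hd : ∀ j ∈ J, Disjoint e (M j)) : IsSystem E (insert c J) (Function.update M c e) := by
  refine ⟨fun j hj => ?_, fun i hi j hj hij => ?_⟩
  · by_cases h : j = c
    · subst h; simpa using he
    · simpa [Function.update_of_ne h] using hM.1 j (Finset.mem_of_mem_insert_of_ne hj h)
  · by_cases h : i = c
    · subst h
      have hj' := Finset.mem_of_mem_insert_of_ne hj hij.symm
      simpa [Function.update_of_ne hij.symm] using hd j hj'
    · have hi' := Finset.mem_of_mem_insert_of_ne hi h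
      by_cases h' : j = c
      · subst h'
        simpa [Function.update_of_ne h] using (hd i hi').symm
      · have hj' := Finset.mem_of_mem_insert_of_ne hj h'
        simpa [Function.update_of_ne h, Function.update_of_ne h'] using hM.2 i hi' j hj' hij

variable [DecidableEq α]

/-- Rearranging a system outside `C`, one can free a member of some `E c` with `c ∈ C`. -/
lemma IsSystem.exists_free {E : ι → Set (Finset α)} {k : ℕ} (hk : ∀ i, ∀ e ∈ E i, #e ≤ k)
    (hE : ∀ I : Finset ι, I.Nonempty → ∀ W : Finset α, #W ≤ 2 * k * #I →
      ∃ i ∈ I, ∃ e ∈ E i, Disjoint e W)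
    {J : Finset ι} (n : ℕ) (C : Finset ι) (W : Finset α) (M : ι → Finset α)
    (hn : #(J \ C) ≤ n) (hC : C.Nonempty) (hW : #W ≤ 2 * k * #C) (hM : IsSystem E J M)
    (hCW : ∀ j ∈ J, j ∈ C → M j ⊆ W) (hJW : ∀ j ∈ J, j ∉ C → Disjoint (M j) W) :
    ∃ M', IsSystem E J M' ∧ (∀ j ∈ C, M' j = M j) ∧ (∀ j ∈ J, j ∉ C → Disjoint (M' j) W) ∧
      ∃ c ∈ C, ∃ e ∈ E c, Disjoint e W ∧ ∀ j ∈ J, Disjoint e (M' j) := by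
  induction n generalizing C W M with
  | zero =>
    obtain ⟨c, hc, e, he, hd⟩ := hE C hC W hW
    refine ⟨M, hM, fun _ _ => rfl, hJW, c, hc, e, he, hd, fun j hj => ?_⟩
    have hjC : j ∈ C := by
      by_contra h
      have : j ∈ J \ C := Finset.mem_sdiff.2 ⟨hj, h⟩
      have := Finset.card_pos.2 ⟨j, this⟩
      omega
    exact hd.mono_right (hCW j hj hjC)
  | succ n ih =>
    obtain ⟨c, hc, e, he, hd⟩ := hE C hC W hW
    -- Inner induction on the number of members of the system that block `e`; the outer one is on
    -- the number of indices of `J` outside `C`.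
    suffices H : ∀ m (M₁ : ι → Finset α), #{j ∈ J | ¬ Disjoint e (M₁ j)} ≤ m → IsSystem E J M₁ →
        (∀ j ∈ C, M₁ j = M j) → (∀ j ∈ J, j ∉ C → Disjoint (M₁ j) W) →
        ∃ M', IsSystem E J M' ∧ (∀ j ∈ C, M' j = M j) ∧ (∀ j ∈ J, j ∉ C → Disjoint (M' j) W) ∧
          ∃ c ∈ C, ∃ e ∈ E c, Disjoint e W ∧ ∀ j ∈ J, Disjoint e (M' j) from
      H _ M le_rfl hM (fun _ _ => rfl) hJW
    intro m
    induction m with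
    | zero =>
      intro M₁ hm hM₁ hMC hMW
      refine ⟨M₁, hM₁, hMC, hMW, c, hc, e, he, hd, fun j hj => ?_⟩
      by_contra h
      have : j ∈ {j ∈ J | ¬ Disjoint e (M₁ j)} := Finset.mem_filter.2 ⟨hj, h⟩
      have := Finset.card_pos.2 ⟨j, this⟩
      omega
    | succ m ihm =>
      intro M₁ hm hM₁ hMC hMW
      set A := {j ∈ J | ¬ Disjoint e (M₁ j)} with hA
      have hAC : Disjoint C A := by
        rw [Finset.disjoint_left]
        intro j hjC hjA
        obtain ⟨hj, hne⟩ := Finset.mem_filter.1 hjA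
        rw [hMC j hjC] at hne
        exact hne (hd.mono_right (hCW j hj hjC))
      rcases A.eq_empty_or_nonempty with h0 | hne
      · exact ihm M₁ (by rw [← hA, h0]; simp) hM₁ hMC hMW
      have hApos := Finset.card_pos.2 hne
      -- The blockers become frozen indices. The set `W'` has at most `2k|C| + k + k|A|` elements,
      -- which is at most `2k|C ∪ A|` because `A` is nonempty and disjoint from `C`; this is the
      -- reason for the factor 2 in the hypothesis.
      set W' := W ∪ (e ∪ A.biUnion M₁) with hW'
      obtain ⟨M', hM', hM'C, hM'W, c', hc', e', he', hd', hfree⟩ := ih (C ∪ A) W' M₁ (by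
          have hsub : J \ (C ∪ A) ⊂ J \ C := by
            refine ⟨Finset.sdiff_subset_sdiff le_rfl Finset.subset_union_left, fun h => ?_⟩
            obtain ⟨j, hj⟩ := hne
            have := h (Finset.mem_sdiff.2 ⟨(Finset.mem_filter.1 hj).1,
              fun hjC => Finset.disjoint_left.1 hAC hjC hj⟩)
            exact (Finset.mem_sdiff.1 this).2 (Finset.mem_union_right _ hj)
          have := Finset.card_lt_card hsub
          omega)
        (hC.mono Finset.subset_union_left) (by
          have h1 : #(A.biUnion M₁) ≤ #A * k := Finset.card_biUnion_le_card_mul _ _ _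
            fun j hj => hk j _ (hM₁.1 j (Finset.mem_filter.1 hj).1)
          have h2 := hk c e he
          have h3 := Finset.card_union_le W (e ∪ A.biUnion M₁)
          have h4 := Finset.card_union_le e (A.biUnion M₁)
          rw [Finset.card_union_of_disjoint hAC]
          nlinarith) hM₁ (by
          intro j hj hjCA
          rcases Finset.mem_union.1 hjCA with h | h
          · rw [hMC j h]
            exact (hCW j hj h).trans Finset.subset_union_left
          · exact (Finset.subset_biUnion_of_mem M₁ h).trans
              (Finset.subset_union_right.trans Finset.subset_union_right)) (by
          intro j hj hjCA
          rw [Finset.mem_union, not_or] at hjCA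
          refine Finset.disjoint_union_right.2 ⟨hMW j hj hjCA.1, Finset.disjoint_union_right.2 ⟨?_, ?_⟩⟩
          · by_contra h
            exact hjCA.2 (Finset.mem_filter.2 ⟨hj, fun h' => h h'.symm⟩)
          · refine (Finset.disjoint_biUnion_right _ _ _).2 fun i hi => ?_
            exact hM₁.2 j hj i (Finset.mem_filter.1 hi).1 (fun h => hjCA.2 (h ▸ hi)))
      have hWW' : W ⊆ W' := Finset.subset_union_left
      have heW' : e ⊆ W' := Finset.subset_union_left.trans Finset.subset_union_right
      have hM'C2 : ∀ j ∈ C, M' j = M j := fun j hj =>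
        (hM'C j (Finset.mem_union_left _ hj)).trans (hMC j hj)
      have hM'W2 : ∀ j ∈ J, j ∉ C → Disjoint (M' j) W := by
        intro j hj hjC
        by_cases hjA : j ∈ A
        · rw [hM'C j (Finset.mem_union_right _ hjA)]
          exact hMW j hj hjC
        · exact (hM'W j hj (by simp [hjC, hjA])).mono_right hWW'
      rcases Finset.mem_union.1 hc' with hc'C | hc'A
      · exact ⟨M', hM', hM'C2, hM'W2, c', hc'C, e', he', hd'.mono_right hWW', hfree⟩
      have hc'J : c' ∈ J := (Finset.mem_filter.1 hc'A).1
      have hc'C : c' ∉ C := fun h => Finset.disjoint_left.1 hAC h hc'A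
      -- The freed index is a blocker. Moving it to `e'`, which avoids `W'` and hence `e`, lowers
      -- the number of blockers and creates no new one.
      refine ihm (Function.update M' c' e') ?_ ?_ ?_ ?_
      · have hsub : {j ∈ J | ¬ Disjoint e (Function.update M' c' e' j)} ⊆ A.erase c' := by
          intro j hj
          obtain ⟨hjJ, hne⟩ := Finset.mem_filter.1 hj
          by_cases h : j = c'
          · subst h
            rw [Function.update_self] at hne
            exact absurd (hd'.mono_right heW').symm hne
          rw [Function.update_of_ne h] at hne
          refine Finset.mem_erase.2 ⟨h, ?_⟩
          by_contra hjA
          by_cases hjC : j ∈ C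
          · rw [hM'C2 j hjC] at hne
            exact hne (hd.mono_right (hCW j hjJ hjC))
          · exact hne ((hM'W j hjJ (by simp [hjC, hjA])).mono_right heW').symm
        have := Finset.card_le_card hsub
        rw [Finset.card_erase_of_mem hc'A] at this
        omega
      · have := hM'.update he' hfree
        rwa [Finset.insert_eq_of_mem hc'J] at this
      · intro j hj
        rw [Function.update_of_ne (show j ≠ c' from fun h => hc'C (h ▸ hj)), hM'C2 j hj]
      · intro j hj hjC
        by_cases h : j = c'
        · subst h
          rw [Function.update_self]
          exact hd'.mono_right hWW'
        · rw [Function.update_of_ne h]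
          exact hM'W2 j hj hjC

/-- **Haxell's theorem** on disjoint representatives for families of sets of size at most `k`. -/
theorem exists_disjoint_representatives [Fintype ι] {E : ι → Set (Finset α)} {k : ℕ}
    (hk : ∀ i, ∀ e ∈ E i, #e ≤ k)
    (hE : ∀ I : Finset ι, I.Nonempty → ∀ W : Finset α, #W ≤ 2 * k * #I →
      ∃ i ∈ I, ∃ e ∈ E i, Disjoint e W) :
    ∃ M : ι → Finset α, (∀ i, M i ∈ E i) ∧ ∀ i j, i ≠ j → Disjoint (M i) (M j) := by
  suffices H : ∀ J : Finset ι, ∃ M, IsSystem E J M by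
    obtain ⟨M, h1, h2⟩ := H univ
    exact ⟨M, fun i => h1 i (mem_univ _), fun i j => h2 i (mem_univ _) j (mem_univ _)⟩
  intro J
  induction J using Finset.induction_on with
  | empty => exact ⟨fun _ => ∅, by simp [IsSystem]⟩
  | insert a J ha ih =>
    obtain ⟨M, hM⟩ := ih
    obtain ⟨M', hM', -, -, c, hc, e, he, -, hfree⟩ := IsSystem.exists_free hk hE _ {a} ∅ M le_rfl
      (Finset.singleton_nonempty a) (by simp) hM
      (fun j hj hja => absurd (Finset.mem_singleton.1 hja ▸ hj) ha) (by simp)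
    obtain rfl := Finset.mem_singleton.1 hc
    exact ⟨_, hM'.update he hfree⟩

end Representatives

/-! ### Sparse bipartite subgraphs of expanders -/

section Expansion

variable {V : Type*} [Fintype V] [DecidableEq V] {G : SimpleGraph V} [DecidableRel G.Adj]
  {ε s : ℝ}

/-- In an expander, between a set `B` and its complement there are many edges forming a subgraph
with prescribed bounds for the degrees on both sides, even if a small set `W` is removed. -/
lemma IsExpander.exists_sparse_subgraph (hG : IsExpander G ε s)
    (hεn : ε / Real.logb 2 (Fintype.card V) ^ 2 ≤ 1) {B W : Finset V}
    (hB1 : 1 ≤ #B) (hB : (#B : ℝ) ≤ 2 / 3 * Fintype.card V)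
    (hW : (G.maxDegree : ℝ) * #W ≤ s * #B / 4) {d D : ℕ} (hd : 4 * (d : ℝ) ≤ s) (hD : 0 < D)
    (hdD : 4 * (d : ℝ) * G.maxDegree ≤ s * D) :
    ∃ H : Finset (V × V), (∀ e ∈ H, e.1 ∈ B ∧ e.2 ∉ B ∧ e.2 ∉ W ∧ G.Adj e.1 e.2) ∧
      (∀ u, #{e ∈ H | e.1 = u} ≤ D) ∧ (∀ v, #{e ∈ H | e.2 = v} ≤ d) ∧
      d * (ε * #B / Real.logb 2 (Fintype.card V) ^ 2) ≤ (#H : ℝ) := by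
  classical
  set P : Finset (V × V) → Prop := fun H =>
    (∀ e ∈ H, e.1 ∈ B ∧ e.2 ∉ B ∧ e.2 ∉ W ∧ G.Adj e.1 e.2) ∧
      (∀ u, #{e ∈ H | e.1 = u} ≤ D) ∧ (∀ v, #{e ∈ H | e.2 = v} ≤ d) with hP
  obtain ⟨H, hHP, hmax⟩ : ∃ H, P H ∧ ∀ H', P H' → H ⊆ H' → H' = H := by
    obtain ⟨H, hH, hmax⟩ := (Finset.univ.filter P).exists_max_image (fun H => #H)
      ⟨∅, by simp [hP]⟩
    refine ⟨H, (Finset.mem_filter.1 hH).2, fun H' hH' hsub => ?_⟩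
    exact (Finset.eq_of_subset_of_card_le hsub (hmax H' (by simpa using hH'))).symm
  obtain ⟨hH1, hH2, hH3⟩ := hHP
  refine ⟨H, hH1, hH2, hH3, ?_⟩
  -- The negated bound is also needed along the way: it gives `|H| ≤ d |B|`, so the edges of the
  -- maximal `H` are few enough to be deleted.
  by_contra! hlt
  set l := Real.logb 2 (Fintype.card V) with hl
  have hb0 : (0 : ℝ) ≤ #B := Nat.cast_nonneg _
  have hd0 : (0 : ℝ) ≤ d := Nat.cast_nonneg _
  have hHle : (#H : ℝ) ≤ d * #B := by
    refine hlt.le.trans (mul_le_mul_of_nonneg_left ?_ hd0)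
    have := mul_le_mul_of_nonneg_right hεn hb0
    rw [one_mul] at this
    exact le_trans (by rw [mul_div_right_comm]) this
  set C : Finset V := {u | #{e ∈ H | e.1 = u} = D} with hC
  set Z : Finset V := {v | #{e ∈ H | e.2 = v} = d} with hZ
  have hCard : D * #C ≤ #H := by
    rw [Finset.card_eq_sum_card_fiberwise (f := Prod.fst) (t := univ) (fun _ _ => by simp)]
    calc D * #C = ∑ _u ∈ C, D := by rw [Finset.sum_const, smul_eq_mul, mul_comm]
      _ = ∑ u ∈ C, #{e ∈ H | e.1 = u} :=
          Finset.sum_congr rfl (fun u hu => (Finset.mem_filter.1 hu).2.symm)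
      _ ≤ _ := Finset.sum_le_sum_of_subset (Finset.subset_univ _)
  have hZcard : d * #Z ≤ #H := by
    rw [Finset.card_eq_sum_card_fiberwise (f := Prod.snd) (t := univ) (fun _ _ => by simp)]
    calc d * #Z = ∑ _u ∈ Z, d := by rw [Finset.sum_const, smul_eq_mul, mul_comm]
      _ = ∑ u ∈ Z, #{e ∈ H | e.2 = u} :=
          Finset.sum_congr rfl (fun u hu => (Finset.mem_filter.1 hu).2.symm)
      _ ≤ _ := Finset.sum_le_sum_of_subset (Finset.subset_univ _)
  -- Each of `H`, the edges at `W` and the edges at saturated left vertices costs at most `s |B| /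
  -- 4`. After deletion, by maximality of `H`, any remaining edge leaving `B` ends at a saturated
  -- right vertex.
  set F : Finset (Sym2 V) := H.image (fun e => s(e.1, e.2)) ∪
    (W ∪ C).biUnion (fun v => G.incidenceFinset v) with hF
  have hFE : (F : Set (Sym2 V)) ⊆ G.edgeSet := by
    intro e he
    rcases Finset.mem_union.1 (Finset.mem_coe.1 he) with h | h
    · obtain ⟨x, hx, rfl⟩ := Finset.mem_image.1 h
      exact (hH1 x hx).2.2.2
    · obtain ⟨x, -, hx⟩ := Finset.mem_biUnion.1 h
      exact G.incidenceSet_subset x (by simpa using hx)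
  have hFc : (#F : ℝ) ≤ #H + (G.maxDegree * #W + G.maxDegree * #C) := by
    have h1 : #F ≤ #H + (#W + #C) * G.maxDegree := by
      refine (Finset.card_union_le _ _).trans (add_le_add Finset.card_image_le ?_)
      refine (Finset.card_biUnion_le_card_mul _ _ G.maxDegree fun v _ => ?_).trans
        (Nat.mul_le_mul_right _ (Finset.card_union_le _ _))
      rw [G.card_incidenceFinset_eq_degree]
      exact G.degree_le_maxDegree v
    have h2 : (#F : ℝ) ≤ #H + (#W + #C) * G.maxDegree := by exact_mod_cast h1
    linarith
  have hDC : (G.maxDegree : ℝ) * #C ≤ s * #B / 4 := by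
    have hD' : (0 : ℝ) < D := by exact_mod_cast hD
    have h1 : (D : ℝ) * #C ≤ d * #B := le_trans (by exact_mod_cast hCard) hHle
    have hΔ : (0 : ℝ) ≤ G.maxDegree := Nat.cast_nonneg _
    have h2 := mul_le_mul_of_nonneg_left h1 hΔ
    have h3 := mul_le_mul_of_nonneg_right hdD hb0
    refine le_of_mul_le_mul_left (a := (D : ℝ)) ?_ hD'
    nlinarith
  have hFs : (#F : ℝ) ≤ s * #B := by
    have h3 := mul_le_mul_of_nonneg_right hd hb0
    nlinarith
  have key := hG B F hFE hB1 hB hFs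
  have hsub : extNeighbors (G.deleteEdges (F : Set (Sym2 V))) B ⊆ (Z : Set V) := by
    rintro v ⟨hvB, u, huB, huv⟩
    rw [SimpleGraph.deleteEdges_adj] at huv
    obtain ⟨hadj, hnF⟩ := huv
    rw [Finset.mem_coe, hF, Finset.mem_union, not_or] at hnF
    have hinc : ∀ x, (x = u ∨ x = v) → s(u, v) ∈ G.incidenceFinset x := by
      intro x hx
      rw [SimpleGraph.mem_incidenceFinset]
      refine ⟨hadj, ?_⟩
      simpa using hx
    have hvW : v ∉ W := fun h => hnF.2 (Finset.mem_biUnion.2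
      ⟨v, Finset.mem_union_left _ h, hinc v (Or.inr rfl)⟩)
    have huC : u ∉ C := fun h => hnF.2 (Finset.mem_biUnion.2
      ⟨u, Finset.mem_union_right _ h, hinc u (Or.inl rfl)⟩)
    have huvH : (u, v) ∉ H := fun h => hnF.1 (Finset.mem_image.2 ⟨_, h, rfl⟩)
    by_contra hvZ
    have huC' : #{e ∈ H | e.1 = u} ≠ D := fun h => huC (by simp [hC, h])
    have hvZ' : #{e ∈ H | e.2 = v} ≠ d := fun h => hvZ (by simp [hZ, h])
    have := hmax (insert (u, v) H) ⟨?_, ?_, ?_⟩ (Finset.subset_insert _ _)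
    · exact huvH (this ▸ Finset.mem_insert_self _ _)
    · intro e he
      rcases Finset.mem_insert.1 he with rfl | he
      · exact ⟨huB, hvB, hvW, hadj⟩
      · exact hH1 e he
    · intro x
      rw [Finset.filter_insert]
      split_ifs with h
      · refine (Finset.card_insert_le _ _).trans ?_
        have := hH2 x
        simp only at h
        subst h
        omega
      · exact hH2 x
    · intro x
      rw [Finset.filter_insert]
      split_ifs with h
      · refine (Finset.card_insert_le _ _).trans ?_
        have := hH3 x
        simp only at h
        subst h
        omega
      · exact hH3 x
  have hle : ((extNeighbors (G.deleteEdges (F : Set (Sym2 V))) B).ncard : ℝ) ≤ #Z := by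
    have := Set.ncard_le_ncard hsub (Finset.finite_toSet _)
    rw [Set.ncard_coe_finset] at this
    exact_mod_cast this
  have h5 := mul_le_mul_of_nonneg_left (key.trans hle) hd0
  have h6 : (d : ℝ) * #Z ≤ #H := by exact_mod_cast hZcard
  linarith

/-- Otherwise all edges at `v` could be deleted, leaving `{v}` without neighbours. -/
lemma IsExpander.lt_degree (hG : IsExpander G ε s) (hε0 : 0 < ε) (hn : 2 ≤ Fintype.card V)
    (v : V) : s < G.degree v := by
  by_contra! h
  have hn' : (2 : ℝ) ≤ Fintype.card V := by exact_mod_cast hn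
  have hl : 0 < Real.logb 2 (Fintype.card V) := Real.logb_pos (by norm_num) (by linarith)
  have key := hG {v} (G.incidenceFinset v) (by
    intro e he
    exact G.incidenceSet_subset v (by simpa using he)) (by simp) (by simp; linarith)
    (by simpa using h)
  have : extNeighbors (G.deleteEdges (G.incidenceFinset v : Set (Sym2 V))) {v} = ∅ := by
    rw [Set.eq_empty_iff_forall_notMem]
    rintro w ⟨-, u, hu, huw⟩
    obtain rfl := Finset.mem_singleton.1 hu
    rw [SimpleGraph.deleteEdges_adj] at huw
    refine huw.2 ?_
    rw [Finset.mem_coe, SimpleGraph.mem_incidenceFinset]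
    exact ⟨huw.1, by simp⟩
  rw [this] at key
  simp only [Finset.card_singleton, Nat.cast_one, mul_one, Set.ncard_empty, Nat.cast_zero] at key
  have : 0 < ε / Real.logb 2 (Fintype.card V) ^ 2 := by positivity
  linarith

lemma mul_div_two_le_one_sub_pow {x : ℝ} (h0 : 0 ≤ x) {k : ℕ} (hk : k * x ≤ 1) :
    k * x / 2 ≤ 1 - (1 - x) ^ k := by
  rcases Nat.eq_zero_or_pos k with rfl | hk0
  · simp
  have hx1 : x ≤ 1 := by
    have : (1 : ℝ) ≤ k := by exact_mod_cast hk0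
    nlinarith
  have h1 : (1 - x) ^ k ≤ Real.exp (-(k * x)) := by
    rw [← mul_neg, Real.exp_nat_mul]
    have := Real.add_one_le_exp (-x)
    exact pow_le_pow_left₀ (by linarith) (by linarith) k
  have hy0 : 0 ≤ k * x := by positivity
  set y := k * x with hy
  have h2 := exp_neg_le_one_sub_half hy0 hk
  linarith

/-- If each right vertex of a bipartite graph `H` with at most `D` edges at each left vertex has
degree at most `2 / q`, then the neighbourhood of a random set of left vertices is large. -/
lemma bernProb_card_neighbors_lt_le {q : ℝ} (h0 : 0 ≤ q) (h1 : q ≤ 1) (H : Finset (V × V)) {D : ℕ}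
    (hD : 0 < D) (hHD : ∀ u, #{e ∈ H | e.1 = u} ≤ D)
    (hHd : ∀ v, q * (#{e ∈ H | e.2 = v} : ℝ) ≤ 2) :
    bernProb q (fun S => (#{v | ∃ u ∈ S, (u, v) ∈ H} : ℝ) < q * #H / 8) ≤
      Real.exp (-(q * #H / (8 * D))) := by
  have hD' : (0 : ℝ) < D := by exact_mod_cast hD
  set N : Finset V → Finset V := fun S => {v | ∃ u ∈ S, (u, v) ∈ H} with hN
  have hNi : ∀ S a, N (insert a S) = N S ∪ ({v | (a, v) ∈ H} : Finset V) := by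
    intro S a
    ext v
    simp [hN, or_and_right, exists_or, or_comm]
  have hNa : ∀ a, #({v | (a, v) ∈ H} : Finset V) ≤ D := by
    intro a
    refine le_trans ?_ (hHD a)
    refine Finset.card_le_card_of_injOn (fun v => (a, v)) ?_ ?_
    · intro v hv
      simpa using hv
    · intro v _ w _ h
      simpa using h
  have hE : q * #H / 4 ≤ bernExp (q / 2) univ (fun S => (#(N S) : ℝ)) := by
    have e1 : ∀ S : Finset V, (#(N S) : ℝ) =
        ∑ v, (1 + (-1) * if Disjoint ({u | (u, v) ∈ H} : Finset V) S then (1 : ℝ) else 0) := by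
      intro S
      rw [hN, Finset.card_filter]
      push_cast
      refine Finset.sum_congr rfl fun v _ => ?_
      have : (∃ u ∈ S, (u, v) ∈ H) ↔ ¬ Disjoint ({u | (u, v) ∈ H} : Finset V) S := by
        rw [Finset.not_disjoint_iff]
        simp [and_comm]
      by_cases h : Disjoint ({u | (u, v) ∈ H} : Finset V) S <;> simp [this, h]
    have e2 : ∀ v, #({u | (u, v) ∈ H} : Finset V) = #{e ∈ H | e.2 = v} := by
      intro v
      refine Finset.card_bij (fun u _ => (u, v)) ?_ ?_ ?_
      · intro u hu; simpa using hu
      · intro u _ w _ h; simpa using h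
      · rintro ⟨u, w⟩ h
        simp only [Finset.mem_filter] at h
        obtain ⟨h, rfl⟩ := h
        exact ⟨u, by simpa using h, rfl⟩
    rw [funext e1, bernExp_sum]
    simp only [bernExp_add, bernExp_const, bernExp_mul_left, bernExp_disjoint _ (subset_univ _), e2]
    have e3 : (#H : ℝ) = ∑ v, (#{e ∈ H | e.2 = v} : ℝ) := by
      rw [Finset.card_eq_sum_card_fiberwise (f := Prod.snd) (t := univ) (fun _ _ => by simp)]
      push_cast
      rfl
    rw [e3, Finset.mul_sum, Finset.sum_div]
    refine Finset.sum_le_sum fun v _ => ?_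
    have := mul_div_two_le_one_sub_pow (x := q / 2) (by linarith) (k := #{e ∈ H | e.2 = v})
      (by have := hHd v; linarith)
    linarith
  -- Adding one left vertex creates at most `D` new neighbours, so dividing by `D` makes the
  -- increments at most 1. The threshold is half of the lower bound for the mean at density `q / 2`.
  have key := bernProb_lt_le (t := q * #H / (8 * D)) h0 h1 (fun S => (D : ℝ)⁻¹ * #(N S))
    (by
      intro S a
      rw [hNi]
      gcongr
      exact Finset.subset_union_left)
    (by
      intro S a
      have h2 : (#(N (insert a S)) : ℝ) ≤ #(N S) + D := by
        rw [hNi]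
        exact_mod_cast (Finset.card_union_le _ _).trans (Nat.add_le_add_left (hNa a) _)
      calc (D : ℝ)⁻¹ * #(N (insert a S)) ≤ (D : ℝ)⁻¹ * (#(N S) + D) := by gcongr
        _ = _ := by field_simp)
  refine (bernProb_mono h0 h1 fun S hS => ?_).trans (key.trans (Real.exp_le_exp.2 ?_))
  · calc (D : ℝ)⁻¹ * #(N S) < (D : ℝ)⁻¹ * (q * #H / 8) := by gcongr
      _ = q * #H / (8 * D) := by field_simp
  · rw [bernExp_mul_left]
    have : (D : ℝ)⁻¹ * (q * #H / 4) ≤ (D : ℝ)⁻¹ * bernExp (q / 2) univ (fun S => (#(N S) : ℝ)) := by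
      gcongr
    have h3 : (D : ℝ)⁻¹ * (q * #H / 4) = 2 * (q * #H / (8 * D)) := by field_simp; ring
    linarith

end Expansion

/-! ### Growing a set through a random set -/

section Growth

variable {V : Type*} [Fintype V] [DecidableEq V] (G : SimpleGraph V) [DecidableRel G.Adj]

/-- `B` together with the vertices outside `W` that are adjacent to a vertex of `B ∩ S`. -/
def grow (S W B : Finset V) : Finset V :=
  B ∪ ({v | v ∉ W ∧ ∃ u ∈ B, u ∈ S ∧ G.Adj u v} : Finset V)

variable {G}

lemma mem_grow {S W B : Finset V} {v : V} :
    v ∈ grow G S W B ↔ v ∈ B ∨ v ∉ W ∧ ∃ u ∈ B, u ∈ S ∧ G.Adj u v := by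
  simp [grow]

lemma subset_grow (S W B : Finset V) : B ⊆ grow G S W B := Finset.subset_union_left

lemma grow_mono {S S' W B B' : Finset V} (hS : S ⊆ S') (hB : B ⊆ B') :
    grow G S W B ⊆ grow G S' W B' := by
  intro v
  simp only [mem_grow]
  rintro (h | ⟨h, u, hu, hS', ha⟩)
  · exact Or.inl (hB h)
  · exact Or.inr ⟨h, u, hB hu, hS hS', ha⟩

/-- A new vertex needs only one neighbour in the current set, so growth distributes over unions.
This lets growth of a whole family be attributed to its parts. -/
lemma grow_biUnion {ι : Type*} (S W : Finset V) (X : Finset ι) (B : ι → Finset V) :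
    grow G S W (X.biUnion B) ⊆ X.biUnion (fun x => grow G S W (B x)) := by
  intro v hv
  simp only [mem_grow, Finset.mem_biUnion] at hv ⊢
  rcases hv with ⟨x, hx, hv⟩ | ⟨hW, u, ⟨x, hx, hu⟩, hS, ha⟩
  · exact ⟨x, hx, Or.inl hv⟩
  · exact ⟨x, hx, Or.inr ⟨hW, u, hu, hS, ha⟩⟩

lemma subset_iterate_grow (S W B : Finset V) (k : ℕ) : B ⊆ (grow G S W)^[k] B := by
  induction k with
  | zero => exact subset_rfl
  | succ k ih => rw [Function.iterate_succ_apply']; exact ih.trans (subset_grow _ _ _)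

lemma iterate_grow_mono {S S' W B B' : Finset V} (hS : S ⊆ S') (hB : B ⊆ B') (k : ℕ) :
    (grow G S W)^[k] B ⊆ (grow G S' W)^[k] B' := by
  induction k with
  | zero => exact hB
  | succ k ih => simpa only [Function.iterate_succ_apply'] using grow_mono hS ih

lemma iterate_grow_biUnion {ι : Type*} (S W : Finset V) (X : Finset ι) (B : ι → Finset V) (k : ℕ) :
    (grow G S W)^[k] (X.biUnion B) ⊆ X.biUnion (fun x => (grow G S W)^[k] (B x)) := by
  induction k with
  | zero => exact subset_rfl
  | succ k ih =>
    simp only [Function.iterate_succ_apply']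
    exact (grow_mono subset_rfl ih).trans (grow_biUnion _ _ _ _)

/-- Growing through `S ∪ T` goes at least as far as growing first through `S`, then through `T`. -/
lemma iterate_grow_union (S T W B : Finset V) (k l : ℕ) :
    (grow G T W)^[l] ((grow G S W)^[k] B) ⊆ (grow G (S ∪ T) W)^[k + l] B := by
  rw [Nat.add_comm, Function.iterate_add_apply]
  exact iterate_grow_mono subset_union_right
    (iterate_grow_mono subset_union_left subset_rfl k) l

/-- In an expander, one step through a random set enlarges a given set with high probability. -/
lemma IsExpander.bernProb_card_grow_lt_le {ε s q : ℝ} (hG : IsExpander G ε s) (hε0 : 0 < ε)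
    (hn : 2 ≤ Fintype.card V) (hεn : ε / Real.logb 2 (Fintype.card V) ^ 2 ≤ 1)
    (hq0 : 0 < q) (hq1 : q ≤ 1) (hqs : 8 ≤ q * s) {B W : Finset V}
    {b : ℝ} (hb : 0 < b) (hbB : b ≤ #B)
    (hB : (#B : ℝ) ≤ 2 / 3 * Fintype.card V) (hW : (G.maxDegree : ℝ) * #W ≤ s * b / 4) :
    bernProb q (fun S => (#(grow G S W B) : ℝ) <
        (1 + ε / (8 * Real.logb 2 (Fintype.card V) ^ 2)) * #B) ≤
      Real.exp (-(ε * q * s * b / (128 * G.maxDegree * Real.logb 2 (Fintype.card V) ^ 2))) := by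
  set l := Real.logb 2 (Fintype.card V) with hl
  have hn' : (2 : ℝ) ≤ Fintype.card V := by exact_mod_cast hn
  have hl0 : 0 < l := Real.logb_pos (by norm_num) (by linarith)
  have hs0 : 0 < s := by
    by_contra! h
    have := mul_nonpos_of_nonneg_of_nonpos hq0.le h
    linarith
  obtain ⟨v₀⟩ : Nonempty V := Fintype.card_pos_iff.1 (by omega)
  have hsΔ : s ≤ G.maxDegree :=
    (hG.lt_degree hε0 hn v₀).le.trans (by exact_mod_cast G.degree_le_maxDegree v₀)
  have hΔ0 : (0 : ℝ) < G.maxDegree := hs0.trans_le hsΔ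
  have hB1 : 1 ≤ #B := by
    have : (0 : ℝ) < #B := hb.trans_le hbB
    exact_mod_cast this
  -- This is the right degree at which a random sample hits a right vertex with constant
  -- probability: `1 ≤ q * d ≤ 2`. Then `D` is the least left degree allowed for this `d`.
  set d := ⌈1 / q⌉₊ with hd
  have hd1 : 1 / q ≤ d := Nat.le_ceil _
  have hd2 : (d : ℝ) ≤ 2 / q := by
    have h1 : (d : ℝ) < 1 / q + 1 := Nat.ceil_lt_add_one (by positivity)
    have h2 : 1 ≤ 1 / q := (one_le_div hq0).2 hq1
    have h3 : 2 / q = 1 / q + 1 / q := by ring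
    linarith
  have hqd1 : 1 ≤ q * d := by rwa [div_le_iff₀' hq0] at hd1
  have hqd2 : q * d ≤ 2 := by rwa [le_div_iff₀' hq0] at hd2
  have hds : 4 * (d : ℝ) ≤ s := by
    refine le_of_mul_le_mul_left (a := q) ?_ hq0
    linarith
  set D := ⌈4 * (d : ℝ) * G.maxDegree / s⌉₊ with hD
  have hd0 : (0 : ℝ) < d := by
    have : 0 < 1 / q := by positivity
    linarith
  have hDpos : 0 < D := Nat.ceil_pos.2 (by positivity)
  have hD' : (0 : ℝ) < D := by exact_mod_cast hDpos
  have hD1 : 4 * (d : ℝ) * G.maxDegree / s ≤ D := Nat.le_ceil _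
  have hD2 : (D : ℝ) ≤ 16 * G.maxDegree / (q * s) := by
    have h1 : (D : ℝ) < 4 * (d : ℝ) * G.maxDegree / s + 1 := Nat.ceil_lt_add_one (by positivity)
    have h2 : 4 * (d : ℝ) * G.maxDegree / s ≤ 8 * G.maxDegree / (q * s) := by
      rw [div_le_div_iff₀ hs0 (by positivity)]
      have := mul_le_mul_of_nonneg_right hqd2 (mul_nonneg hΔ0.le hs0.le)
      nlinarith
    have h3 : 1 ≤ 8 * G.maxDegree / (q * s) := by
      rw [one_le_div (by positivity)]
      nlinarith
    have h4 : 16 * G.maxDegree / (q * s) = 8 * G.maxDegree / (q * s) + 8 * G.maxDegree / (q * s) := by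
      ring
    linarith
  obtain ⟨H, hH1, hH2, hH3, hH4⟩ := hG.exists_sparse_subgraph hεn hB1 hB
    (hW.trans (by gcongr)) hds hDpos (by rwa [div_le_iff₀' hs0] at hD1)
  rw [← hl] at hH4
  have hqH : ε * #B / l ^ 2 ≤ q * #H := by
    have h1 := mul_le_mul_of_nonneg_left hH4 hq0.le
    have h2 : 0 ≤ ε * #B / l ^ 2 := by positivity
    nlinarith
  refine (bernProb_mono hq0.le hq1 fun S hS => ?_).trans
    ((bernProb_card_neighbors_lt_le hq0.le hq1 H hDpos hH2 (fun v => ?_)).trans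
      (Real.exp_le_exp.2 (neg_le_neg ?_)))
  · have hsub : B ∪ ({v | ∃ u ∈ S, (u, v) ∈ H} : Finset V) ⊆ grow G S W B := by
      refine Finset.union_subset (subset_grow _ _ _) fun v hv => ?_
      obtain ⟨u, hu, huv⟩ := (Finset.mem_filter.1 hv).2
      obtain ⟨h1, h2, h3, h4⟩ := hH1 _ huv
      exact mem_grow.2 (Or.inr ⟨h3, u, h1, hu, h4⟩)
    have hdis : Disjoint B ({v | ∃ u ∈ S, (u, v) ∈ H} : Finset V) := by
      rw [Finset.disjoint_right]
      intro v hv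
      obtain ⟨u, hu, huv⟩ := (Finset.mem_filter.1 hv).2
      exact (hH1 _ huv).2.1
    have hc := Finset.card_le_card hsub
    rw [Finset.card_union_of_disjoint hdis] at hc
    have hc' : (#B : ℝ) + #({v | ∃ u ∈ S, (u, v) ∈ H} : Finset V) ≤ #(grow G S W B) := by
      exact_mod_cast hc
    have h5 : (1 + ε / (8 * l ^ 2)) * #B = #B + ε * #B / l ^ 2 / 8 := by field_simp
    rw [h5] at hS
    linarith
  · have h1 : (#{e ∈ H | e.2 = v} : ℝ) ≤ d := by exact_mod_cast hH3 v
    nlinarith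
  · calc ε * q * s * b / (128 * G.maxDegree * l ^ 2)
        = (ε * b / l ^ 2) / (8 * (16 * G.maxDegree / (q * s))) := by field_simp; ring
      _ ≤ q * #H / (8 * D) := by
        gcongr
        refine le_trans ?_ hqH
        gcongr

variable {W : Finset V} {q γ η b : ℝ}

/-- Iterated growth through a random set, given that single steps succeed. -/
lemma bernProb_iterate_grow_lt_le (hq0 : 0 ≤ q) (hq1 : q ≤ 1) (hγ : 0 ≤ γ) (hη : 0 ≤ η) {t : ℝ}
    (hstep : ∀ B : Finset V, b ≤ #B → (#B : ℝ) ≤ t →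
      bernProb q (fun S => (#(grow G S W B) : ℝ) < (1 + γ) * #B) ≤ η)
    (L : ℕ) (B : Finset V) (hB : b ≤ #B) :
    bernProb (1 - (1 - q) ^ L) (fun S => (#((grow G S W)^[L] B) : ℝ) < min t ((1 + γ) ^ L * #B)) ≤
      L * η := by
  induction L generalizing B with
  | zero =>
    rw [bernProb_false]
    · simp
    · intro S
      simp
  | succ L ih =>
    by_cases ht : t < #B
    · rw [bernProb_false]
      · positivity
      · intro S hS
        have h1 : (#B : ℝ) ≤ #((grow G S W)^[L + 1] B) := by
          exact_mod_cast Finset.card_le_card (subset_iterate_grow S W B (L + 1))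
        have := hS.trans_le (min_le_left _ _)
        linarith
    have hp0 : 0 ≤ (1 - q) ^ L := pow_nonneg (by linarith) _
    have hp1 : (1 - q) ^ L ≤ 1 := pow_le_one₀ (by linarith) (by linarith)
    -- One layer is split off for the first step; the other `L` layers are independent of it.
    have e : 1 - (1 - q) ^ (L + 1) = 1 - (1 - q) * (1 - (1 - (1 - q) ^ L)) := by ring
    rw [e]
    refine (bernProb_union_le hq0 hq1 (c := L * η) (by linarith) (by linarith) (by positivity)
      (fun S => (#(grow G S W B) : ℝ) < (1 + γ) * #B) _
      (fun S T => (#((grow G T W)^[L] (grow G S W B)) : ℝ) <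
        min t ((1 + γ) ^ L * #(grow G S W B))) ?_ ?_).trans ?_
    · intro S T hST
      by_contra! h
      obtain ⟨h1, h2⟩ := h
      have h3 : (#((grow G T W)^[L] (grow G S W B)) : ℝ) ≤ #((grow G (S ∪ T) W)^[L + 1] B) := by
        have := iterate_grow_union (G := G) S T W B 1 L
        rw [Nat.add_comm 1 L] at this
        exact_mod_cast Finset.card_le_card this
      have h4 : min t ((1 + γ) ^ (L + 1) * #B) ≤ min t ((1 + γ) ^ L * #(grow G S W B)) := by
        refine min_le_min_left _ ?_
        rw [pow_succ, mul_assoc]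
        gcongr
      linarith
    · intro S _
      refine ih _ (hB.trans ?_)
      exact_mod_cast Finset.card_le_card (subset_grow _ _ _)
    · have := hstep B hB (not_lt.1 ht)
      push_cast
      linarith

/-- If a family of sets covers many vertices, then one of its members grows to a large set. -/
lemma bernProb_forall_iterate_grow_lt_le {ι : Type*} [DecidableEq ι]
    (hq0 : 0 ≤ q) (hq1 : q ≤ 1) (hη : 0 ≤ η) {t : ℝ}
    (hb : 0 < b) (hbt : 2 * b ≤ t) {L : ℕ}
    (hphase : ∀ B : Finset V, b ≤ #B →
      bernProb (1 - (1 - q) ^ L) (fun S => (#((grow G S W)^[L] B) : ℝ) < t) ≤ η)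
    (j : ℕ) (X : Finset ι) (B : ι → Finset V) (hX : #X ≤ 2 ^ j)
    (hB : b ≤ #(X.biUnion B)) :
    bernProb (1 - (1 - q) ^ (L * (j + 1)))
      (fun S => ∀ x ∈ X, (#((grow G S W)^[L * (j + 1)] (B x)) : ℝ) < t) ≤ (j + 1) * η := by
  have hp0 : ∀ m, 0 ≤ (1 - q) ^ m := fun m => pow_nonneg (by linarith) _
  have hp1 : ∀ m, (1 - q) ^ m ≤ 1 := fun m => pow_le_one₀ (by linarith) (by linarith)
  induction j generalizing X B with
  | zero =>
    have hne : X.Nonempty := by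
      rw [Finset.nonempty_iff_ne_empty]
      rintro rfl
      simp at hB
      linarith
    obtain ⟨x, rfl⟩ := Finset.card_eq_one.1 (le_antisymm (by simpa using hX) hne.card_pos)
    simp only [Finset.singleton_biUnion] at hB
    simpa using hphase (B x) hB
  | succ j ih =>
    have e : 1 - (1 - q) ^ (L * (j + 1 + 1)) =
        1 - (1 - (1 - (1 - q) ^ L)) * (1 - (1 - (1 - q) ^ (L * (j + 1)))) := by ring
    rw [e]
    refine (bernProb_union_le (c := (j + 1) * η) (by linarith [hp1 L]) (by linarith [hp0 L])
      (by linarith [hp1 (L * (j + 1))]) (by linarith [hp0 (L * (j + 1))]) (by positivity)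
      (fun S => (#((grow G S W)^[L] (X.biUnion B)) : ℝ) < t) _
      (fun S T => ∀ x ∈ X, (#((grow G T W)^[L * (j + 1)] ((grow G S W)^[L] (B x))) : ℝ) < t)
      ?_ ?_).trans ?_
    · intro S T hST
      refine Or.inr fun x hx => lt_of_le_of_lt ?_ (hST x hx)
      have := iterate_grow_union (G := G) S T W (B x) L (L * (j + 1))
      rw [show L + L * (j + 1) = L * (j + 1 + 1) by ring] at this
      exact_mod_cast Finset.card_le_card this
    · intro S hS
      have hS := not_lt.1 hS
      -- The grown sets together cover at least `t ≥ 2 * b` vertices, so one of the two halves of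
      -- `X` covers at least `b`. The threshold `b` is thus the same at every level.
      obtain ⟨X₁, hX₁, hcard⟩ := Finset.exists_subset_card_eq (s := X) (n := #X / 2) (by omega)
      have hc2 : #(X \ X₁) = #X - #X / 2 := by rw [Finset.card_sdiff_of_subset hX₁, hcard]
      set B' : ι → Finset V := fun x => (grow G S W)^[L] (B x) with hB'
      have hcov : (#((grow G S W)^[L] (X.biUnion B)) : ℝ) ≤
          #(X₁.biUnion B') + #((X \ X₁).biUnion B') := by
        have h1 := iterate_grow_biUnion (G := G) S W X B L
        have h2 : X.biUnion B' = X₁.biUnion B' ∪ (X \ X₁).biUnion B' := by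
          rw [← Finset.union_biUnion, Finset.union_sdiff_of_subset hX₁]
        exact_mod_cast (Finset.card_le_card h1).trans (by rw [h2]; exact Finset.card_union_le _ _)
      have hpow : 2 ^ (j + 1) = 2 * 2 ^ j := by ring
      have hfin : ∀ Y ⊆ X, #Y ≤ 2 ^ j → b ≤ #(Y.biUnion B') →
          bernProb (1 - (1 - q) ^ (L * (j + 1)))
            (fun T => ∀ x ∈ X, (#((grow G T W)^[L * (j + 1)] (B' x)) : ℝ) < t) ≤ (j + 1) * η := by
        intro Y hY hYc hYb
        refine (bernProb_mono (by linarith [hp1 (L * (j + 1))]) (by linarith [hp0 (L * (j + 1))])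
          fun T hT x hx => hT x (hY hx)).trans
          (ih Y B' hYc hYb)
      by_cases h1 : b ≤ #(X₁.biUnion B')
      · exact hfin X₁ hX₁ (by omega) h1
      · exact hfin (X \ X₁) Finset.sdiff_subset (by omega) (by push Not at h1; linarith)
    · have := hphase _ hB
      push_cast
      linarith

end Growth

/-! ### Paths from growing sets -/

section Paths

lemma card_le_length_of_coe_eq_internalVertices {V : Type*} [DecidableEq V]
    {G : SimpleGraph V} {x y : V} (P : G.Walk x y) {e : Finset V}
    (he : (e : Set V) = internalVertices P) : #e ≤ P.length := by
  have hsub : e ⊆ P.support.tail.toFinset := by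
    intro v hv
    have hv' : v ∈ internalVertices P := he ▸ (Finset.mem_coe.2 hv)
    obtain ⟨h1, h2, -⟩ := hv'
    rw [← SimpleGraph.Walk.cons_tail_support, List.mem_cons] at h1
    exact List.mem_toFinset.2 (h1.resolve_left h2)
  refine (Finset.card_le_card hsub).trans ((List.toFinset_card_le _).trans ?_)
  simp

variable {V : Type*} [Fintype V] [DecidableEq V] {G : SimpleGraph V} [DecidableRel G.Adj]

/-- A vertex can be reached without lying in `S`, but growth continues only through vertices of `S`.
So the last vertex alone may be outside `S`, and `T` has to supply it. -/
lemma exists_walk_of_mem_iterate_grow {S W B : Finset V} (hBW : Disjoint B W) {k : ℕ} {v : V}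
    (hv : v ∈ (grow G S W)^[k] B) :
    ∃ u ∈ B, ∃ w : G.Walk u v, w.length ≤ k ∧ ∀ z ∈ w.support, z ∉ W ∧ (z ≠ v → z ∈ S) := by
  induction k generalizing v with
  | zero =>
    refine ⟨v, hv, .nil, by simp, fun z hz => ?_⟩
    obtain rfl : z = v := by simpa using hz
    exact ⟨Finset.disjoint_left.1 hBW hv, fun h => absurd rfl h⟩
  | succ k ih =>
    rw [Function.iterate_succ_apply'] at hv
    rcases mem_grow.1 hv with hv | ⟨hvW, u', hu', hu'S, hadj⟩
    · obtain ⟨u, hu, w, hw, h⟩ := ih hv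
      exact ⟨u, hu, w, by omega, h⟩
    · obtain ⟨u, hu, w, hw, h⟩ := ih hu'
      refine ⟨u, hu, w.concat hadj, by simpa using hw, fun z hz => ?_⟩
      rw [SimpleGraph.Walk.support_concat, List.mem_append,
        List.mem_singleton] at hz
      rcases hz with hz | rfl
      · refine ⟨(h z hz).1, fun _ => ?_⟩
        by_cases hzu : z = u'
        · exact hzu ▸ hu'S
        · exact (h z hz).2 hzu
      · exact ⟨hvW, fun h => absurd rfl h⟩

/-- Two vertices whose neighbourhoods grow to sets that meet in `T` are joined by a short path. -/
lemma exists_path_of_mem_iterate_grow {S T W : Finset V} {k : ℕ} {x y z : V} (hz : z ∈ T)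
    (hx : z ∈ (grow G S W)^[k] (G.neighborFinset x \ W))
    (hy : z ∈ (grow G S W)^[k] (G.neighborFinset y \ W)) :
    ∃ P : G.Walk x y, P.IsPath ∧ P.length ≤ 2 * k + 2 ∧
      ∀ v ∈ internalVertices P, v ∈ S ∪ T ∧ v ∉ W := by
  obtain ⟨u, hu, w, hw, h⟩ := exists_walk_of_mem_iterate_grow Finset.sdiff_disjoint hx
  obtain ⟨u', hu', w', hw', h'⟩ := exists_walk_of_mem_iterate_grow Finset.sdiff_disjoint hy
  have hxu : G.Adj x u := by simpa using (Finset.mem_sdiff.1 hu).1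
  have hyu : G.Adj u' y := by
    have : G.Adj y u' := by simpa using (Finset.mem_sdiff.1 hu').1
    exact this.symm
  set q : G.Walk x y := (SimpleGraph.Walk.cons hxu (w.append w'.reverse)).concat hyu with hq
  refine ⟨q.bypass, q.bypass_isPath, ?_, ?_⟩
  · refine (q.length_bypass_le_length).trans ?_
    simp [hq]
    omega
  · rintro v ⟨hv, hvx, hvy⟩
    have hv' := q.support_bypass_subset_support hv
    have key : v ∈ w.support ∨ v ∈ w'.support := by
      rw [hq, SimpleGraph.Walk.support_concat, List.mem_append,
        List.mem_singleton, SimpleGraph.Walk.support_cons, List.mem_cons,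
        SimpleGraph.Walk.mem_support_append_iff, SimpleGraph.Walk.support_reverse,
        List.mem_reverse] at hv'
      tauto
    have aux : ∀ {c} (h : v ∉ W ∧ (v ≠ c → v ∈ S)), c = z → v ∈ S ∪ T ∧ v ∉ W := by
      rintro c ⟨h1, h2⟩ rfl
      refine ⟨Finset.mem_union.2 ?_, h1⟩
      by_cases hc : v = c
      · exact Or.inr (hc ▸ hz)
      · exact Or.inl (h2 hc)
    rcases key with hv | hv
    · exact aux (h v hv) rfl
    · exact aux (h' v hv) rfl

/-- If each vertex of `S` is adjacent to few of the vertices `f i`, then these vertices have many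
neighbours. -/
lemma card_mul_le_card_biUnion_neighborFinset {ι : Type*} [Fintype ι] {S W : Finset V}
    {D Q c : ℝ} (hD : 0 < D) (hS : ∀ v, D * Q ≤ #(G.neighborFinset v ∩ S)) {f : ι → V}
    (hf : ∀ v ∈ S, ({i | G.Adj v (f i)}.ncard : ℝ) ≤ D) (hQ : 2 * c ≤ Q) (I : Finset ι)
    (hW : (#W : ℝ) ≤ c * #I) :
    #I * Q ≤ 2 * #((I.image f).biUnion fun x => G.neighborFinset x \ W) := by
  classical
  set N := (I.image f).biUnion fun x => G.neighborFinset x ∩ S with hN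
  set M := (I.image f).biUnion fun x => G.neighborFinset x \ W with hM
  -- Double counting of incidences between indices and neighbours in `S`: at least `D * Q` per
  -- index, at most `D` per vertex.
  have h1 : ∑ i ∈ I, #(G.neighborFinset (f i) ∩ S) = ∑ v ∈ N, #{i ∈ I | G.Adj v (f i)} := by
    have : ∀ i ∈ I, G.neighborFinset (f i) ∩ S = {v ∈ N | G.Adj v (f i)} := by
      intro i hi
      ext v
      simp only [hN, Finset.mem_inter, SimpleGraph.mem_neighborFinset, Finset.mem_filter,
        Finset.mem_biUnion, Finset.mem_image]
      constructor
      · rintro ⟨ha, hv⟩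
        exact ⟨⟨f i, ⟨i, hi, rfl⟩, ha, hv⟩, ha.symm⟩
      · rintro ⟨⟨_, _, _, hv⟩, ha⟩
        exact ⟨ha.symm, hv⟩
    rw [Finset.sum_congr rfl fun i hi => by rw [this i hi]]
    exact Finset.sum_card_bipartiteAbove_eq_sum_card_bipartiteBelow (fun i v => G.Adj v (f i))
  have h2 : (#I : ℝ) * (D * Q) ≤ #N * D := by
    have e1 : (#I : ℝ) * (D * Q) ≤ ∑ i ∈ I, (#(G.neighborFinset (f i) ∩ S) : ℝ) := by
      rw [← nsmul_eq_mul]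
      exact Finset.card_nsmul_le_sum _ _ _ fun i _ => hS (f i)
    have e2 : ∑ v ∈ N, (#{i ∈ I | G.Adj v (f i)} : ℝ) ≤ #N * D := by
      rw [← nsmul_eq_mul]
      refine Finset.sum_le_card_nsmul _ _ _ fun v hv => ?_
      obtain ⟨x, -, hx⟩ := Finset.mem_biUnion.1 hv
      refine le_trans ?_ (hf v (Finset.mem_inter.1 hx).2)
      have : (({i ∈ I | G.Adj v (f i)} : Finset ι) : Set ι) ⊆ {i | G.Adj v (f i)} := by
        intro i hi
        exact (Finset.mem_filter.1 hi).2
      have := Set.ncard_le_ncard this (Set.toFinite _)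
      rw [Set.ncard_coe_finset] at this
      exact_mod_cast this
    have h1' : ∑ i ∈ I, (#(G.neighborFinset (f i) ∩ S) : ℝ) =
        ∑ v ∈ N, (#{i ∈ I | G.Adj v (f i)} : ℝ) := by exact_mod_cast h1
    linarith
  have h3 : (#I : ℝ) * Q ≤ #N := by
    refine le_of_mul_le_mul_right (a := D) ?_ hD
    linarith
  have h4 : (#N : ℝ) ≤ #M + #W := by
    have : N ⊆ M ∪ W := by
      intro v hv
      obtain ⟨x, hx, hxv⟩ := Finset.mem_biUnion.1 hv
      by_cases hvW : v ∈ W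
      · exact Finset.mem_union_right _ hvW
      · exact Finset.mem_union_left _ (Finset.mem_biUnion.2
          ⟨x, hx, Finset.mem_sdiff.2 ⟨(Finset.mem_inter.1 hxv).1, hvW⟩⟩)
    exact_mod_cast (Finset.card_le_card this).trans (Finset.card_union_le _ _)
  have h5 : (0 : ℝ) ≤ #I := Nat.cast_nonneg _
  nlinarith

/-- Deterministic conditions under which `S ∪ T` is connecting. -/
lemma isConnecting_of_grow {S T : Finset V} {D Q l θ : ℝ} {N : ℕ} (hD : 0 < D)
    (hl : l = Real.logb 2 (Fintype.card V) ^ 6) (hl0 : 0 ≤ l)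
    (hQ : 8 * l ≤ Q) (hN : 2 * (N : ℝ) + 2 ≤ l)
    (hdeg : ∀ v, D * Q ≤ #(G.neighborFinset v ∩ S))
    (hgrow : ∀ X W : Finset V, X.Nonempty →
      #X * Q ≤ 2 * #(X.biUnion fun x => G.neighborFinset x \ W) →
      #W * Q ≤ 8 * l * #(X.biUnion fun x => G.neighborFinset x \ W) →
      ∃ x ∈ X, θ ≤ #((grow G S W)^[N] (G.neighborFinset x \ W)))
    (hjoin : ∀ W : Finset V, #W * Q ≤ 8 * l * Fintype.card V → ∀ x y,
      θ ≤ #((grow G S W)^[N] (G.neighborFinset x \ W)) →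
      θ ≤ #((grow G S W)^[N] (G.neighborFinset y \ W)) →
      ∃ z ∈ T, z ∈ (grow G S W)^[N] (G.neighborFinset x \ W) ∧
        z ∈ (grow G S W)^[N] (G.neighborFinset y \ W)) :
    IsConnecting G D (S ∪ T : Finset V) := by
  classical
  intro r x y hx hy hxy
  have hxD : ∀ v ∈ S, ({i | G.Adj v (x i)}.ncard : ℝ) ≤ D := fun v hv =>
    le_trans (by exact_mod_cast Nat.le_add_right _ _)
      (hxy v (Finset.mem_coe.2 (Finset.mem_union_left _ hv)))
  have hyD : ∀ v ∈ S, ({i | G.Adj v (y i)}.ncard : ℝ) ≤ D := fun v hv =>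
    le_trans (by exact_mod_cast Nat.le_add_left _ _)
      (hxy v (Finset.mem_coe.2 (Finset.mem_union_left _ hv)))
  set E : Fin r → Set (Finset V) := fun i => {e | ∃ P : G.Walk (x i) (y i), P.IsPath ∧
    (P.length : ℝ) ≤ l ∧ (e : Set V) = internalVertices P ∧ e ⊆ S ∪ T} with hE
  suffices H : ∃ M : Fin r → Finset V, (∀ i, M i ∈ E i) ∧ ∀ i j, i ≠ j → Disjoint (M i) (M j) by
    obtain ⟨M, hM, hdis⟩ := H
    choose P hP hlen hint hsub using hM
    refine ⟨P, fun i => ⟨hP i, ?_, hl ▸ hlen i⟩, fun i j hij => ?_⟩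
    · rw [← hint i]
      exact_mod_cast hsub i
    · rw [← hint i, ← hint j]
      exact_mod_cast hdis i j hij
  refine exists_disjoint_representatives (k := ⌊l⌋₊) ?_ ?_
  · rintro i e ⟨P, -, hlen, hint, -⟩
    exact (card_le_length_of_coe_eq_internalVertices P hint).trans (Nat.le_floor hlen)
  intro I hI W hW
  have hW' : (#W : ℝ) ≤ 2 * l * #I := by
    have h1 : (#W : ℝ) ≤ 2 * (⌊l⌋₊ : ℝ) * #I := by exact_mod_cast hW
    have h2 := Nat.floor_le hl0
    exact h1.trans (by gcongr)
  have hQ0 : 0 ≤ Q := by linarith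
  -- If `K` has at least half as many elements as `I`, then `|W| ≤ 4 * l * |K|`, so `W` removes at
  -- most half of the guaranteed neighbours.
  have key : ∀ (f : Fin r → V), (∀ v ∈ S, ({i | G.Adj v (f i)}.ncard : ℝ) ≤ D) →
      ∀ K : Finset (Fin r), #I ≤ 2 * #K →
      #(K.image f) * Q ≤ 2 * #((K.image f).biUnion fun x => G.neighborFinset x \ W) ∧
      #W * Q ≤ 8 * l * #((K.image f).biUnion fun x => G.neighborFinset x \ W) := by
    intro f hf K hK
    have hK' : (#I : ℝ) ≤ 2 * #K := by exact_mod_cast hK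
    have hWK : (#W : ℝ) ≤ 4 * l * #K := by nlinarith
    have h1 := card_mul_le_card_biUnion_neighborFinset hD hdeg hf (c := 4 * l) (by linarith) K hWK
    constructor
    · refine le_trans ?_ h1
      gcongr
      exact Finset.card_image_le
    · calc (#W : ℝ) * Q ≤ 4 * l * #K * Q := by gcongr
        _ = 4 * l * (#K * Q) := by ring
        _ ≤ 4 * l * (2 * #((K.image f).biUnion fun x => G.neighborFinset x \ W)) := by gcongr
        _ = _ := by ring
  have hbad : ∀ (f : Fin r → V), (∀ v ∈ S, ({i | G.Adj v (f i)}.ncard : ℝ) ≤ D) →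
      2 * #{i ∈ I | ¬ θ ≤ #((grow G S W)^[N] (G.neighborFinset (f i) \ W))} < #I := by
    intro f hf
    by_contra hK
    rw [not_lt] at hK
    set K := {i ∈ I | ¬ θ ≤ #((grow G S W)^[N] (G.neighborFinset (f i) \ W))} with hKdef
    obtain ⟨h1, h2⟩ := key f hf K hK
    have hKne : K.Nonempty := by
      rw [← Finset.card_pos]
      have := hI.card_pos
      omega
    obtain ⟨v, hv, hvθ⟩ := hgrow _ W (hKne.image f) h1 h2
    obtain ⟨i, hi, rfl⟩ := Finset.mem_image.1 hv
    exact (Finset.mem_filter.1 hi).2 hvθ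
  have hWn : (#W : ℝ) * Q ≤ 8 * l * Fintype.card V := by
    refine (key x hxD I (by omega)).2.trans ?_
    gcongr
    exact Finset.card_le_univ _
  obtain ⟨i, hi, hix, hiy⟩ : ∃ i ∈ I, θ ≤ #((grow G S W)^[N] (G.neighborFinset (x i) \ W)) ∧
      θ ≤ #((grow G S W)^[N] (G.neighborFinset (y i) \ W)) := by
    by_contra! h
    have hsub : I ⊆ {i ∈ I | ¬ θ ≤ #((grow G S W)^[N] (G.neighborFinset (x i) \ W))} ∪
        {i ∈ I | ¬ θ ≤ #((grow G S W)^[N] (G.neighborFinset (y i) \ W))} := by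
      intro i hi
      rw [Finset.mem_union, Finset.mem_filter, Finset.mem_filter]
      by_cases h1 : θ ≤ #((grow G S W)^[N] (G.neighborFinset (x i) \ W))
      · exact Or.inr ⟨hi, not_le.2 (h i hi h1)⟩
      · exact Or.inl ⟨hi, h1⟩
    have := (Finset.card_le_card hsub).trans (Finset.card_union_le _ _)
    have h1 := hbad x hxD
    have h2 := hbad y hyD
    omega
  obtain ⟨z, hzT, hzx, hzy⟩ := hjoin W hWn _ _ hix hiy
  obtain ⟨P, hP, hlen, hint⟩ := exists_path_of_mem_iterate_grow hzT hzx hzy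
  refine ⟨i, hi, (Set.toFinite (internalVertices P)).toFinset, ⟨P, hP, ?_, by simp, ?_⟩, ?_⟩
  · refine le_trans ?_ hN
    exact_mod_cast hlen
  · intro v hv
    exact (hint v (by simpa using hv)).1
  · rw [Finset.disjoint_left]
    intro v hv
    exact (hint v (by simpa using hv)).2

end Paths

/-! ### Probability estimates -/

section Estimates

lemma bernProb_card_inter_lt_le {α : Type*} [Fintype α] [DecidableEq α] {q t : ℝ} (h0 : 0 ≤ q)
    (h1 : q ≤ 1) (A : Finset α) :
    bernProb q (fun S => (#(A ∩ S) : ℝ) < t) ≤ Real.exp (t - q / 2 * #A) := by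
  have hE : bernExp (q / 2) univ (fun S => (#(A ∩ S) : ℝ)) = q / 2 * #A := by
    have e1 : ∀ S : Finset α, (#(A ∩ S) : ℝ) =
        ∑ v ∈ A, (1 + (-1) * if Disjoint {v} S then (1 : ℝ) else 0) := by
      intro S
      rw [← Finset.filter_mem_eq_inter, Finset.card_filter]
      push_cast
      refine Finset.sum_congr rfl fun v _ => ?_
      by_cases h : v ∈ S <;> simp [h]
    rw [funext e1, bernExp_sum]
    simp only [bernExp_add, bernExp_const, bernExp_mul_left, bernExp_disjoint _ (subset_univ _)]
    simp
    ring
  rw [← hE]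
  refine bernProb_lt_le h0 h1 _ (fun S a => ?_) (fun S a => ?_)
  · gcongr
    exact Finset.subset_insert _ _
  · have : A ∩ insert a S ⊆ insert a (A ∩ S) := by
      intro v
      simp only [Finset.mem_inter, Finset.mem_insert]
      tauto
    exact_mod_cast (Finset.card_le_card this).trans (Finset.card_insert_le _ _)

/-- For union bounds over all vertex sets: with weight `n⁻²` per element the total is bounded. -/
lemma sum_pow_card_le_three {α : Type*} [Fintype α] [DecidableEq α] {a : ℝ} (ha : 0 ≤ a)
    (h : Fintype.card α * a ≤ 1) : ∑ W : Finset α, a ^ #W ≤ 3 := by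
  have h1 := Fintype.sum_pow_mul_eq_add_pow α a 1
  simp only [one_pow, mul_one] at h1
  rw [h1]
  calc (a + 1) ^ Fintype.card α ≤ Real.exp a ^ Fintype.card α := by
        gcongr
        exact Real.add_one_le_exp a
    _ = Real.exp (Fintype.card α * a) := (Real.exp_nat_mul _ _).symm
    _ ≤ Real.exp 1 := Real.exp_le_exp.2 h
    _ ≤ 3 := Real.exp_one_lt_three.le

lemma exp_half_le_one_add {x : ℝ} (h0 : 0 ≤ x) (h1 : x ≤ 1) : Real.exp (x / 2) ≤ 1 + x := by
  have h2 : 1 - x / 2 ≤ Real.exp (-(x / 2)) := by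
    have := Real.add_one_le_exp (-(x / 2)); linarith
  rw [Real.exp_neg] at h2
  have h3 : 0 < 1 - x / 2 := by linarith
  have h4 : Real.exp (x / 2) ≤ (1 - x / 2)⁻¹ := by
    rwa [le_inv_comm₀ h3 (Real.exp_pos _)] at h2
  refine h4.trans ?_
  rw [inv_le_iff_one_le_mul₀ h3]
  nlinarith

/-- A density whose `N`-fold union has density `p`. -/
lemma exists_one_sub_pow_eq {p : ℝ} (h0 : 0 ≤ p) (h1 : p ≤ 1) {N : ℕ} (hN : N ≠ 0) :
    ∃ q : ℝ, 0 ≤ q ∧ q ≤ 1 ∧ p ≤ N * q ∧ (1 - q) ^ N = 1 - p := by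
  have hp : 0 ≤ 1 - p := by linarith
  have e0 : 0 ≤ (1 - p) ^ (N⁻¹ : ℝ) := Real.rpow_nonneg hp _
  have e1 : (1 - p) ^ (N⁻¹ : ℝ) ≤ 1 := Real.rpow_le_one hp (by linarith) (by positivity)
  have e2 : ((1 - p) ^ (N⁻¹ : ℝ)) ^ N = 1 - p := Real.rpow_inv_natCast_pow hp hN
  refine ⟨1 - (1 - p) ^ (N⁻¹ : ℝ), by linarith, by linarith, ?_, by simpa using e2⟩
  have := one_add_mul_le_pow (a := -(1 - (1 - p) ^ (N⁻¹ : ℝ))) (by linarith) N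
  rw [show 1 + -(1 - (1 - p) ^ (N⁻¹ : ℝ)) = (1 - p) ^ (N⁻¹ : ℝ) by ring, e2] at this
  linarith

lemma log_le_logb_two {x : ℝ} (hx : 1 ≤ x) : Real.log x ≤ Real.logb 2 x := by
  rw [Real.logb, le_div_iff₀ (Real.log_pos (by norm_num))]
  have h1 : 0 ≤ Real.log x := Real.log_nonneg hx
  have h2 : Real.log 2 ≤ 1 := by have := Real.log_two_lt_d9; linarith
  nlinarith

lemma inv_sq_eq_exp_neg_log {x : ℝ} (hx : 0 < x) : (x ^ 2)⁻¹ = Real.exp (-(2 * Real.log x)) := by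
  rw [Real.exp_neg, show 2 * Real.log x = ((2 : ℕ) : ℝ) * Real.log x by norm_num,
    Real.exp_nat_mul, Real.exp_log hx]

lemma const_le_pow_of_le {l c : ℝ} (hl : 2 ^ 200 ≤ l) (hc : c ≤ 2 ^ 200) {k : ℕ} (hk : k ≠ 0) :
    c ≤ l ^ k :=
  hc.trans (hl.trans (le_self_pow₀ (le_trans (by norm_num) hl) hk))

section Numeric

variable {ε s p q l Δ Q x w m : ℝ}

/-- The edges at a removed set of `w` vertices are few. -/
lemma mul_le_of_mul_le_eight (hl : 2 ^ 200 ≤ l) (hp0 : 0 < p) (hp1 : p ≤ 1) (hs0 : 0 < s)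
    (hm : 0 ≤ m) (hQ : Q = Δ * l ^ 73 / (8 * p ^ 8 * s))
    (hwQ : w * Q ≤ 8 * l ^ 6 * m) : Δ * w ≤ s * (m / 4) / 4 := by
  have hl1 : 1 ≤ l := le_trans (by norm_num) hl
  have hl0 : 0 < l := by linarith
  have hp8 : p ^ 8 ≤ 1 := pow_le_one₀ hp0.le hp1
  have hQs : 8 * p ^ 8 * s * Q = Δ * l ^ 73 := by rw [hQ]; field_simp
  have h1 : Δ * w * l ^ 73 ≤ s * (m / 4) / 4 * l ^ 73 := by
    calc Δ * w * l ^ 73 = 8 * p ^ 8 * s * (w * Q) := by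
          rw [mul_right_comm, ← hQs]; ring
      _ ≤ 8 * p ^ 8 * s * (8 * l ^ 6 * m) := by gcongr
      _ ≤ 8 * 1 * s * (8 * l ^ 6 * m) := by gcongr
      _ = s * (m / 4) / 4 * (1024 * l ^ 6) := by ring
      _ ≤ s * (m / 4) / 4 * (l ^ 67 * l ^ 6) := by
          gcongr
          exact const_le_pow_of_le hl (by norm_num) (by norm_num)
      _ = s * (m / 4) / 4 * l ^ 73 := by ring
  exact le_of_mul_le_mul_right h1 (by positivity)

/-- The exponent of the failure probability dominates the sizes of the two given sets. -/
lemma pow_mul_add_le_exponent (hε : (2 : ℝ)⁻¹ ^ 90 < ε) (hl : 2 ^ 200 ≤ l) (hp0 : 0 < p)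
    (hp1 : p ≤ 1) (hq0 : 0 < q) (hpq : p ≤ l ^ 5 * q) (hs0 : 0 < s) (hΔ0 : 0 < Δ)
    (hQ : Q = Δ * l ^ 73 / (8 * p ^ 8 * s)) (hx : 0 ≤ x) (hw : 0 ≤ w) (hm : 0 ≤ m)
    (hxQ : x * Q ≤ 2 * m) (hwQ : w * Q ≤ 8 * l ^ 6 * m) :
    l ^ 20 * (x + w) ≤ ε * q * s / (128 * Δ * l ^ 2) * (m / 4) := by
  have hl1 : 1 ≤ l := le_trans (by norm_num) hl
  have hl0 : 0 < l := by linarith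
  have hε0 : 0 < ε := lt_trans (by positivity) hε
  set c : ℝ := ε * q * s / (128 * Δ * l ^ 2) with hc
  have hc0 : 0 < c := by positivity
  -- The factors `s` and `Δ` cancel. Of the remaining `l ^ 71`, a factor `l ^ 5` pays for `p ≤ l ^ 5
  -- * q` and `l ^ 6` for `1024 / ε`.
  have hcQ : l ^ 60 ≤ c * Q := by
    have e1 : c * Q = ε * q * l ^ 71 / (1024 * p ^ 8) := by
      rw [hc, hQ]; field_simp; ring
    rw [e1, le_div_iff₀ (by positivity)]
    have h1 : p ^ 8 ≤ l ^ 5 * q := by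
      refine le_trans ?_ hpq
      calc p ^ 8 ≤ p ^ 1 := pow_le_pow_of_le_one hp0.le hp1 (by norm_num)
        _ = p := pow_one p
    have h2 : (1024 : ℝ) ≤ ε * l ^ 6 := by
      have h4 : (2 : ℝ)⁻¹ ^ 90 * 2 ^ 200 ≤ ε * l ^ 6 := by
        gcongr
        exact const_le_pow_of_le hl le_rfl (by norm_num)
      refine le_trans ?_ h4
      norm_num
    calc l ^ 60 * (1024 * p ^ 8) = 1024 * (l ^ 60 * p ^ 8) := by ring
      _ ≤ (ε * l ^ 6) * (l ^ 60 * (l ^ 5 * q)) := by gcongr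
      _ = ε * q * l ^ 71 := by ring
  set b := m / 4 with hb
  have h1 : c * Q * x ≤ 8 * (c * b) := by
    have := mul_le_mul_of_nonneg_left hxQ hc0.le
    rw [hb]
    linarith
  have h2 : c * Q * w ≤ 32 * l ^ 6 * (c * b) := by
    have := mul_le_mul_of_nonneg_left hwQ hc0.le
    rw [hb]
    linarith
  have h3 : l ^ 60 * x ≤ 8 * (c * b) := le_trans (by gcongr) h1
  have h4 : l ^ 60 * w ≤ 32 * l ^ 6 * (c * b) := le_trans (by gcongr) h2
  have h5 : l ^ 54 * w ≤ 32 * (c * b) := by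
    refine le_of_mul_le_mul_left (a := l ^ 6) ?_ (by positivity)
    linarith
  have h6 : (64 : ℝ) * l ^ 20 ≤ l ^ 54 := by
    have e : l ^ 54 = l ^ 34 * l ^ 20 := by ring
    rw [e]
    gcongr
    exact const_le_pow_of_le hl (by norm_num) (by norm_num)
  have h7 : l ^ 54 ≤ l ^ 60 := pow_le_pow_right₀ hl1 (by norm_num)
  have h8 : 64 * l ^ 20 * x ≤ 8 * (c * b) := le_trans (by gcongr; exact h6.trans h7) h3
  have h9 : 64 * l ^ 20 * w ≤ 32 * (c * b) := le_trans (by gcongr) h5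
  have h10 : 0 ≤ c * b := by positivity
  linarith

end Numeric

variable {V : Type*} [Fintype V] [DecidableEq V] {G : SimpleGraph V} [DecidableRel G.Adj]
  {ε s p q l : ℝ}

/-- For given sets `X` and `W`, the neighbourhood of one of the vertices of `X` outside `W` very
likely grows to a large set, provided that `X` has many neighbours. -/
lemma IsExpander.bernProb_forall_neighbors_lt_le (hG : IsExpander G ε s)
    (hε : (2 : ℝ)⁻¹ ^ 90 < ε) (hε1 : ε < 1) (hl : l = Real.logb 2 (Fintype.card V))
    (hl2 : 2 ^ 200 ≤ l) (hn : 2 ≤ Fintype.card V) (hp0 : 0 < p) (hp1 : p ≤ 1) (hq1 : q ≤ 1)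
    (hpq : p ≤ l ^ 5 * q) (hs : l ^ 30 ≤ p ^ 4 * s) {L J : ℕ} (hL : 2 ^ 100 * l ^ 3 ≤ L)
    (hJ : Fintype.card V ≤ 2 ^ J) (hN : ((L * (J + 1) : ℕ) : ℝ) ≤ l ^ 5)
    {Q : ℝ} (hQ : Q = G.maxDegree * l ^ 73 / (8 * p ^ 8 * s)) {X W : Finset V} (hX : X.Nonempty)
    (hXQ : #X * Q ≤ 2 * #(X.biUnion fun x => G.neighborFinset x \ W))
    (hWQ : #W * Q ≤ 8 * l ^ 6 * #(X.biUnion fun x => G.neighborFinset x \ W)) :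
    bernProb (1 - (1 - q) ^ (L * (J + 1))) (fun S => ∀ x ∈ X,
        (#((grow G S W)^[L * (J + 1)] (G.neighborFinset x \ W)) : ℝ) < 3 / 5 * Fintype.card V) ≤
      ((Fintype.card V : ℝ) ^ 2)⁻¹ * (((Fintype.card V : ℝ) ^ 2)⁻¹ ^ #X *
        ((Fintype.card V : ℝ) ^ 2)⁻¹ ^ #W) := by
  set n := Fintype.card V with hndef
  set m := #(X.biUnion fun x => G.neighborFinset x \ W) with hm
  have hn' : (2 : ℝ) ≤ n := by exact_mod_cast hn
  have hl1 : 1 ≤ l := le_trans (by norm_num) hl2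
  have hl0 : 0 < l := by linarith
  have hε0 : 0 < ε := lt_trans (by positivity) hε
  have hq0 : 0 < q := by
    by_contra! h
    have := mul_nonpos_of_nonneg_of_nonpos (pow_nonneg hl0.le 5) h
    linarith
  have hs0 : 0 < s := by
    by_contra! h
    have h1 := mul_nonpos_of_nonneg_of_nonpos (pow_nonneg hp0.le 4) h
    have h2 : 0 < l ^ 30 := by positivity
    linarith
  obtain ⟨v₀⟩ : Nonempty V := Fintype.card_pos_iff.1 (by omega)
  have hsΔ : s ≤ G.maxDegree :=
    (hG.lt_degree hε0 hn v₀).le.trans (by exact_mod_cast G.degree_le_maxDegree v₀)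
  have hΔ0 : (0 : ℝ) < G.maxDegree := hs0.trans_le hsΔ
  have hQ0 : 0 < Q := by rw [hQ]; positivity
  have hX1 : (1 : ℝ) ≤ #X := by exact_mod_cast hX.card_pos
  have hW0 : (0 : ℝ) ≤ #W := Nat.cast_nonneg _
  have hm0 : (0 : ℝ) < m := by nlinarith
  -- Small enough that `2 * b ≤ 3 / 5 * n`, as the halving requires. The value `3 / 5` itself lies
  -- below `2 / 3`, so expansion applies up to it, and above `1 / 2`, so two grown sets overlap.
  set b : ℝ := m / 4 with hb
  have hb0 : 0 < b := by positivity
  have hmn : (m : ℝ) ≤ n := by exact_mod_cast Finset.card_le_univ _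
  have hln : Real.log n ≤ l := hl ▸ log_le_logb_two (by linarith)
  have hεl : ε / l ^ 2 ≤ 1 := by
    rw [div_le_one (by positivity)]
    have : 1 ≤ l ^ 2 := one_le_pow₀ hl1
    linarith
  have hqs : 8 ≤ q * s := by
    have h1 : l ^ 30 ≤ l ^ 5 * (q * s) := by
      calc l ^ 30 ≤ p ^ 4 * s := hs
        _ ≤ p ^ 1 * s := by gcongr ?_ * _; exact pow_le_pow_of_le_one hp0.le hp1 (by norm_num)
        _ = p * s := by ring
        _ ≤ (l ^ 5 * q) * s := by gcongr
        _ = _ := by ring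
    have h2 : l ^ 30 = l ^ 5 * l ^ 25 := by ring
    rw [h2] at h1
    exact (const_le_pow_of_le hl2 (by norm_num) (by norm_num)).trans
      (le_of_mul_le_mul_left h1 (by positivity))
  have hWs : (G.maxDegree : ℝ) * #W ≤ s * b / 4 :=
    mul_le_of_mul_le_eight hl2 hp0 hp1 hs0 hm0.le hQ hWQ
  set c : ℝ := ε * q * s / (128 * G.maxDegree * l ^ 2) with hc
  have hc0 : 0 < c := by positivity
  have hcb : l ^ 20 * (#X + #W) ≤ c * b := pow_mul_add_le_exponent hε hl2 hp0 hp1 hq0 hpq hs0 hΔ0 hQ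
    (by linarith) hW0 hm0.le hXQ hWQ
  set η : ℝ := Real.exp (-(c * b)) with hη
  set γ : ℝ := ε / (8 * l ^ 2) with hγ
  have hγ0 : 0 < γ := by positivity
  have hγ1 : γ ≤ 1 := by
    rw [hγ, div_le_one (by positivity)]
    have : 1 ≤ l ^ 2 := one_le_pow₀ hl1
    linarith
  have hpow : (n : ℝ) ≤ (1 + γ) ^ L := by
    have h1 : Real.exp (L * (γ / 2)) ≤ (1 + γ) ^ L := by
      rw [Real.exp_nat_mul]
      exact pow_le_pow_left₀ (Real.exp_pos _).le (exp_half_le_one_add hγ0.le hγ1) L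
    refine le_trans ?_ h1
    have h2 : l ≤ L * (γ / 2) := by
      calc l ≤ 2 ^ 100 * l ^ 3 * ((2 : ℝ)⁻¹ ^ 90 / (8 * l ^ 2) / 2) := by
            have : 2 ^ 100 * l ^ 3 * ((2 : ℝ)⁻¹ ^ 90 / (8 * l ^ 2) / 2) = 64 * l := by
              field_simp; norm_num
            linarith
        _ ≤ L * (γ / 2) := by
            rw [hγ]
            gcongr
    calc (n : ℝ) = Real.exp (Real.log n) := (Real.exp_log (by linarith)).symm
      _ ≤ _ := Real.exp_le_exp.2 (hln.trans h2)
  have hphase : ∀ B : Finset V, b ≤ #B → bernProb (1 - (1 - q) ^ L)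
      (fun S => (#((grow G S W)^[L] B) : ℝ) < 3 / 5 * n) ≤ L * η := by
    intro B hB
    have hp0 : 0 ≤ (1 - q) ^ L := pow_nonneg (by linarith) _
    have hp1 : (1 - q) ^ L ≤ 1 := pow_le_one₀ (by linarith) (by linarith)
    refine (bernProb_mono (by linarith) (by linarith) fun S hS => ?_).trans
      (bernProb_iterate_grow_lt_le (G := G) (W := W) (γ := γ) (η := η) (b := b) (t := 3 / 5 * n) hq0.le hq1 hγ0.le
        (Real.exp_pos _).le ?_ L B hB)
    · refine hS.trans_le (le_min le_rfl ?_)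
      have hB1 : (1 : ℝ) ≤ #B := by
        have : (0 : ℝ) < #B := hb0.trans_le hB
        exact_mod_cast this
      have : (1 + γ) ^ L * 1 ≤ (1 + γ) ^ L * #B := by gcongr
      linarith
    · intro B hB hBn
      have := hG.bernProb_card_grow_lt_le hε0 hn (by rw [← hndef, ← hl]; exact hεl) hq0 hq1 hqs
        hb0 hB (by linarith) hWs
      rw [← hndef, ← hl] at this
      refine this.trans (le_of_eq ?_)
      rw [hη, hc]
      congr 2
      ring
  have hfam := bernProb_forall_iterate_grow_lt_le hq0.le hq1 (η := L * η)
    (by positivity) hb0 (t := 3 / 5 * n) (by linarith) hphase J X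
    (fun x => G.neighborFinset x \ W) ((Finset.card_le_univ X).trans hJ) (by rw [← hm]; linarith)
  refine hfam.trans ?_
  have e1 : ((n : ℝ) ^ 2)⁻¹ * (((n : ℝ) ^ 2)⁻¹ ^ #X * ((n : ℝ) ^ 2)⁻¹ ^ #W) =
      Real.exp (-(2 * Real.log n * (1 + (#X + #W)))) := by
    rw [inv_sq_eq_exp_neg_log (by linarith), ← Real.exp_nat_mul, ← Real.exp_nat_mul, ← Real.exp_add, ← Real.exp_add]
    congr 1
    ring
  have e2 : ((J : ℝ) + 1) * (L * η) ≤ Real.exp (l ^ 5 - c * b) := by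
    rw [sub_eq_add_neg, Real.exp_add, ← hη]
    have h1 : ((J : ℝ) + 1) * (L * η) = ((L * (J + 1) : ℕ) : ℝ) * η := by push_cast; ring
    rw [h1]
    refine mul_le_mul_of_nonneg_right ?_ (Real.exp_pos _).le
    have := Real.add_one_le_exp (l ^ 5)
    linarith
  rw [e1]
  refine e2.trans (Real.exp_le_exp.2 ?_)
  have ht : (1 : ℝ) ≤ #X + #W := by linarith
  set t : ℝ := #X + #W with htdef
  have h1 : 2 * Real.log n * (1 + t) ≤ 2 * l * (2 * t) := by gcongr; linarith
  have h2 : l ≤ l ^ 5 := le_self_pow₀ hl1 (by norm_num)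
  have h3 : 5 * l ^ 5 ≤ l ^ 20 := by
    have e : l ^ 20 = l ^ 15 * l ^ 5 := by ring
    rw [e]
    gcongr
    exact const_le_pow_of_le hl2 (by norm_num) (by norm_num)
  have h4 : (4 * l + l ^ 5) * t ≤ l ^ 20 * t := by gcongr; linarith
  have h5 : l ^ 5 * 1 ≤ l ^ 5 * t := by gcongr
  linarith

end Estimates

/-! ### Random sets are connecting -/

section Connecting

/-- The vertex set is finite, so the measure of an event is the sum of its atoms. -/
lemma setBernoulli_real_eq_bernProb {V : Type*} [Fintype V] (p : unitInterval)
    (P : Set V → Prop) :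
    (ProbabilityTheory.setBernoulli (Set.univ : Set V) p).real {S | P S} =
      bernProb (p : ℝ) (fun S : Finset V => P S) := by
  classical
  unfold bernProb bernExp
  have h1 : {S : Set V | P S} =
      ⋃ S ∈ (univ.filter fun S : Finset V => P S), {(S : Set V)} := by
    ext S
    simp only [Set.mem_ofPred_eq, Set.mem_iUnion, Set.mem_singleton_iff, Finset.mem_filter,
      Finset.mem_univ, true_and, exists_prop]
    constructor
    · intro h
      exact ⟨S.toFinset, by simpa using h, by simp⟩
    · rintro ⟨T, hT, rfl⟩
      exact hT
  rw [h1, MeasureTheory.measureReal_biUnion_finset]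
  · rw [Finset.powerset_univ, Finset.sum_filter]
    refine Finset.sum_congr rfl fun S _ => ?_
    rw [ProbabilityTheory.setBernoulli_real_singleton p (Set.subset_univ _) Set.finite_univ]
    have : ((Set.univ : Set V) \ S).ncard = #(univ : Finset V) - #S := by
      rw [← Finset.coe_univ, ← Finset.coe_sdiff, Set.ncard_coe_finset,
        Finset.card_sdiff_of_subset (Finset.subset_univ _)]
    rw [this, Set.ncard_coe_finset]
    by_cases h : P S <;> simp [h]
  · intro S _ T _ hST
    simpa using hST
  · intro S _
    exact MeasurableSet.singleton _

/-- The number `L` of steps of a phase and the number `J` of halvings. -/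
lemma exists_phase_length {n : ℕ} {l : ℝ} (hn : 0 < n) (hl : l = Real.logb 2 n)
    (hl2 : 2 ^ 200 ≤ l) : ∃ L J : ℕ, 2 ^ 100 * l ^ 3 ≤ L ∧ n ≤ 2 ^ J ∧ 1 ≤ L * (J + 1) ∧
      ((L * (J + 1) : ℕ) : ℝ) + 1 ≤ l ^ 5 := by
  have hl1 : 1 ≤ l := le_trans (by norm_num) hl2
  have hl0 : 0 < l := by linarith
  refine ⟨⌈2 ^ 100 * l ^ 3⌉₊, ⌈l⌉₊, Nat.le_ceil _, ?_,
    Nat.mul_pos (Nat.ceil_pos.2 (by positivity)) (Nat.succ_pos _), ?_⟩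
  · have h1 : (n : ℝ) = 2 ^ l := by
      rw [hl, Real.rpow_logb (by norm_num) (by norm_num) (by exact_mod_cast hn)]
    have h2 : (n : ℝ) ≤ 2 ^ ⌈l⌉₊ := by
      rw [h1, ← Real.rpow_natCast]
      exact Real.rpow_le_rpow_of_exponent_le (by norm_num) (Nat.le_ceil _)
    exact_mod_cast h2
  · have h1 : (⌈2 ^ 100 * l ^ 3⌉₊ : ℝ) < 2 ^ 100 * l ^ 3 + 1 := Nat.ceil_lt_add_one (by positivity)
    have h2 : (⌈l⌉₊ : ℝ) < l + 1 := Nat.ceil_lt_add_one hl0.le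
    have h3 : 1 ≤ l ^ 3 := one_le_pow₀ hl1
    have h4 : (1 : ℝ) ≤ l ^ 4 := one_le_pow₀ hl1
    push_cast
    calc (⌈2 ^ 100 * l ^ 3⌉₊ : ℝ) * (⌈l⌉₊ + 1) + 1
        ≤ (2 ^ 101 * l ^ 3) * (3 * l) + l ^ 4 := by
          gcongr <;> linarith
      _ = (3 * 2 ^ 101 + 1) * l ^ 4 := by ring
      _ ≤ l * l ^ 4 := by
          gcongr
          exact le_trans (by norm_num) hl2
      _ = l ^ 5 := by ring

/-- A random set very likely meets a given large set; the bound suffices for a union bound over all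
sets of size `w`. -/
lemma bernProb_disjoint_le {V : Type*} [Fintype V] [DecidableEq V] {p q l Q : ℝ}
    (hl : l = Real.logb 2 (Fintype.card V)) (hl2 : 2 ^ 200 ≤ l) (hn : 1 ≤ Fintype.card V)
    (hp0 : 0 < p) (hq0 : 0 ≤ q) (hq1 : q ≤ 1) (hpq : p ≤ l ^ 5 * q)
    (hpQ : l ^ 73 ≤ 8 * p * Q) (hpn : l ^ 30 ≤ p * Fintype.card V) {w : ℕ}
    (hw : w * Q ≤ 8 * l ^ 6 * Fintype.card V) {A : Finset V}
    (hA : (Fintype.card V : ℝ) / 5 ≤ #A) :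
    bernProb q (fun T => Disjoint A T) ≤
      ((Fintype.card V : ℝ) ^ 2)⁻¹ ^ 2 * ((Fintype.card V : ℝ) ^ 2)⁻¹ ^ w := by
  set n := Fintype.card V with hndef
  have hn' : (1 : ℝ) ≤ n := by exact_mod_cast hn
  have hl1 : 1 ≤ l := le_trans (by norm_num) hl2
  have hl0 : 0 < l := by linarith
  have hln : Real.log n ≤ l := hl ▸ log_le_logb_two hn'
  have h1 : bernProb q (fun T => Disjoint A T) = (1 - q) ^ #A := by
    rw [← bernExp_disjoint q (subset_univ _)]
    unfold bernProb
    congr 1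
    ext T
    congr
  rw [h1, inv_sq_eq_exp_neg_log (by linarith), ← Real.exp_nat_mul, ← Real.exp_nat_mul,
    ← Real.exp_add]
  calc (1 - q) ^ #A ≤ Real.exp (-q) ^ #A := by
        have := Real.add_one_le_exp (-q)
        exact pow_le_pow_left₀ (by linarith) (by linarith) _
    _ = Real.exp (#A * -q) := (Real.exp_nat_mul _ _).symm
    _ ≤ _ := Real.exp_le_exp.2 ?_
  have hw0 : (0 : ℝ) ≤ w := Nat.cast_nonneg _
  have h3 : (n : ℝ) / 5 * q ≤ #A * q := by gcongr
  have h4 : p * n ≤ l ^ 5 * (q * n) := by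
    calc p * n ≤ (l ^ 5 * q) * n := by gcongr
      _ = _ := by ring
  have h5 : l ^ 25 ≤ q * n := by
    refine le_of_mul_le_mul_left (a := l ^ 5) ?_ (by positivity)
    calc l ^ 5 * l ^ 25 = l ^ 30 := by ring
      _ ≤ _ := hpn.trans h4
  have h6 : l ^ 20 * w ≤ q * n := by
    have e2 : l ^ 73 * w ≤ 64 * l ^ 11 * (q * n) := by
      calc l ^ 73 * w ≤ 8 * p * Q * w := by gcongr
        _ = 8 * p * (w * Q) := by ring
        _ ≤ 8 * p * (8 * l ^ 6 * n) := by gcongr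
        _ = 64 * l ^ 6 * (p * n) := by ring
        _ ≤ 64 * l ^ 6 * (l ^ 5 * (q * n)) := by gcongr
        _ = _ := by ring
    have e3 : 64 * l ^ 31 ≤ l ^ 73 := by
      have e : l ^ 73 = l ^ 42 * l ^ 31 := by ring
      rw [e]
      gcongr
      exact const_le_pow_of_le hl2 (by norm_num) (by norm_num)
    refine le_of_mul_le_mul_left (a := 64 * l ^ 11) ?_ (by positivity)
    calc 64 * l ^ 11 * (l ^ 20 * w) = 64 * l ^ 31 * w := by ring
      _ ≤ l ^ 73 * w := by gcongr
      _ ≤ _ := e2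
  have h7 : 100 * l ≤ l ^ 20 := by
    have e : l ^ 20 = l ^ 19 * l := by ring
    rw [e]
    gcongr
    exact const_le_pow_of_le hl2 (by norm_num) (by norm_num)
  have h8 : l ^ 20 ≤ l ^ 25 := pow_le_pow_right₀ hl1 (by norm_num)
  have h9 : 100 * l * w ≤ l ^ 20 * w := by gcongr
  have h10 : Real.log n * w ≤ l * w := by gcongr
  push_cast
  linarith

variable {V : Type*} [Fintype V] [DecidableEq V] {G : SimpleGraph V} [DecidableRel G.Adj]
  {ε s p : ℝ}

/-- A random set of vertices of a large expander is very likely connecting. -/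
lemma IsExpander.bernProb_not_isConnecting_le (hG : IsExpander G ε s)
    (hε : (2 : ℝ)⁻¹ ^ 90 < ε) (hε1 : ε < 1) (hp0 : 0 ≤ p) (hp1 : p ≤ 1)
    (hl2 : 2 ^ 200 ≤ Real.logb 2 (Fintype.card V))
    (hδ : 100 * Real.logb 2 (Fintype.card V) / G.minDegree ≤ p)
    (hs : (p ^ 4)⁻¹ * Real.logb 2 (Fintype.card V) ^ 30 ≤ s) :
    bernProb p (fun S : Finset V => ¬ IsConnecting G (p ^ 9 * s * G.minDegree /
      (G.maxDegree * Real.logb 2 (Fintype.card V) ^ 73)) (S : Set V)) ≤ 13 / Fintype.card V := by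
  set n := Fintype.card V with hndef
  set l := Real.logb 2 n with hl
  have hl1 : 1 ≤ l := le_trans (by norm_num) hl2
  have hl0 : 0 < l := by linarith
  have hn : 2 ≤ n := by
    by_contra! h
    have : n = 0 ∨ n = 1 := by omega
    rcases this with h | h <;> simp [hl, h] at hl0
  have hn' : (2 : ℝ) ≤ n := by exact_mod_cast hn
  have hε0 : 0 < ε := lt_trans (by positivity) hε
  obtain ⟨v₀⟩ : Nonempty V := Fintype.card_pos_iff.1 (by omega)
  have : Nonempty V := ⟨v₀⟩
  -- Division by zero must be excluded in order: `s ≥ 0` holds even if `p = 0`, expansion then gives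
  -- `δ > s ≥ 0`, then `p > 0`, and finally `s > 0`.
  have hs0 : 0 ≤ s := le_trans (by positivity) hs
  have hsδ : s < G.minDegree := by
    obtain ⟨v, hv⟩ := G.exists_minimal_degree_vertex
    rw [hv]
    exact hG.lt_degree hε0 hn v
  have hδ0 : (0 : ℝ) < G.minDegree := hs0.trans_lt hsδ
  have hpδ : 100 * l ≤ p * G.minDegree := by rwa [div_le_iff₀ hδ0] at hδ
  have hp0 : 0 < p := by
    rcases hp0.eq_or_lt with h | h
    · rw [← h] at hpδ; linarith
    · exact h
  have hs : l ^ 30 ≤ p ^ 4 * s := by rwa [inv_mul_le_iff₀ (by positivity)] at hs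
  have hs0 : 0 < s := by
    rcases hs0.eq_or_lt with h | h
    · have : 0 < l ^ 30 := by positivity
      rw [← h] at hs; linarith
    · exact h
  have hδΔ : (G.minDegree : ℝ) ≤ G.maxDegree := by
    exact_mod_cast (G.minDegree_le_degree v₀).trans (G.degree_le_maxDegree v₀)
  have hΔ0 : (0 : ℝ) < G.maxDegree := hδ0.trans_le hδΔ
  have hsΔ : s ≤ G.maxDegree := hsδ.le.trans hδΔ
  have hln : Real.log n ≤ l := log_le_logb_two (by linarith)
  obtain ⟨L, J, hL1, hJ1, hN1, hN2⟩ := exists_phase_length (by omega) hl hl2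
  set N := L * (J + 1) with hN
  obtain ⟨q, hq0, hq1, hpq, hqp⟩ := exists_one_sub_pow_eq hp0.le hp1 (N := N + 1) (by omega)
  have hpq : p ≤ l ^ 5 * q := hpq.trans (by push_cast; gcongr)
  set a := 1 - (1 - q) ^ N with ha
  have hpw0 : 0 ≤ (1 - q) ^ N := pow_nonneg (by linarith) _
  have hpw1 : (1 - q) ^ N ≤ 1 - q := by
    calc (1 - q) ^ N ≤ (1 - q) ^ 1 := pow_le_pow_of_le_one (by linarith) (by linarith) hN1
      _ = 1 - q := pow_one _
  have ha0 : 0 ≤ a := by linarith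
  have ha1 : a ≤ 1 := by linarith
  have hap : p = 1 - (1 - a) * (1 - q) := by
    rw [pow_succ] at hqp
    rw [ha]
    linarith
  -- Since `N ≥ 1`, the `N` layers of `S` have total density `a ≥ q`, while `p ≤ a + q`.
  have hpa : p ≤ 2 * a := by
    have : 0 ≤ a * q := by positivity
    nlinarith
  set Q : ℝ := G.maxDegree * l ^ 73 / (8 * p ^ 8 * s) with hQ
  set D : ℝ := p ^ 9 * s * G.minDegree / (G.maxDegree * l ^ 73) with hD
  have hD0 : 0 < D := by positivity
  have hQ0 : 0 < Q := by positivity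
  have hDQ : D * Q = p * G.minDegree / 8 := by
    rw [hD, hQ]; field_simp
  have hp8 : p ^ 8 ≤ p := by
    calc p ^ 8 ≤ p ^ 1 := pow_le_pow_of_le_one hp0.le hp1 (by norm_num)
      _ = p := pow_one p
  have hpQ : l ^ 73 ≤ 8 * p * Q := by
    have h1 : 8 * p ^ 8 * Q * s = G.maxDegree * l ^ 73 := by rw [hQ]; field_simp
    have h2 : l ^ 73 ≤ 8 * p ^ 8 * Q := by
      refine le_of_mul_le_mul_right (a := s) ?_ hs0
      rw [h1, mul_comm]
      gcongr
    exact h2.trans (by gcongr)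
  have hQl : 8 * l ^ 6 ≤ Q := by
    have h1 : l ^ 73 ≤ 8 * 1 * Q := hpQ.trans (by gcongr)
    have h2 : l ^ 73 = l ^ 67 * l ^ 6 := by ring
    have h4 : l ≤ l ^ 67 := le_self_pow₀ hl1 (by norm_num)
    have h3 : 2 ^ 200 * l ^ 6 ≤ l ^ 67 * l ^ 6 := by gcongr; exact hl2.trans h4
    have h5 : 0 < l ^ 6 := by positivity
    norm_num at *
    linarith
  have hpn : l ^ 30 ≤ p * n := by
    calc l ^ 30 ≤ p ^ 4 * s := hs
      _ ≤ p ^ 1 * s := by gcongr ?_ * _; exact pow_le_pow_of_le_one hp0.le hp1 (by norm_num)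
      _ = p * s := by ring
      _ ≤ p * n := by
        gcongr
        exact hsΔ.trans (by exact_mod_cast G.maxDegree_lt_card_verts.le)
  set θ : ℝ := 3 / 5 * n with hθ
  set A : Finset V → Finset V → V → Finset V := fun S W x =>
    (grow G S W)^[N] (G.neighborFinset x \ W) with hA
  -- These are the pairs for which growth is required, not those for which it fails; likewise `sep`
  -- lists the triples whose two large sets `T` must join.
  set bad : Finset (Finset V × Finset V) := {XW | XW.1.Nonempty ∧
    #XW.1 * Q ≤ 2 * #(XW.1.biUnion fun x => G.neighborFinset x \ XW.2) ∧
    #XW.2 * Q ≤ 8 * l ^ 6 * #(XW.1.biUnion fun x => G.neighborFinset x \ XW.2)} with hbad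
  set sep : Finset V → Finset (Finset V × V × V) := fun S => {w | #w.1 * Q ≤ 8 * l ^ 6 * n ∧
    θ ≤ #(A S w.1 w.2.1) ∧ θ ≤ #(A S w.1 w.2.2)} with hsep
  have hα0 : (0 : ℝ) ≤ ((n : ℝ) ^ 2)⁻¹ := by positivity
  have hα1 : (n : ℝ) * ((n : ℝ) ^ 2)⁻¹ ≤ 1 := by
    rw [pow_two, mul_inv, ← mul_assoc, mul_inv_cancel₀ (by linarith), one_mul]
    exact inv_le_one_of_one_le₀ (by linarith)
  have hsum : ∑ W : Finset V, ((n : ℝ) ^ 2)⁻¹ ^ #W ≤ 3 := sum_pow_card_le_three hα0 hα1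
  have hexp : ((n : ℝ) ^ 2)⁻¹ = Real.exp (-(2 * Real.log n)) := inv_sq_eq_exp_neg_log (by linarith)
  rw [hap]
  refine (bernProb_union_le (c := 3 / n ^ 2) ha0 ha1 hq0 hq1 (by positivity)
    (fun S => (∃ v ∈ (univ : Finset V), (#(G.neighborFinset v ∩ S) : ℝ) < p * G.minDegree / 8) ∨
      ∃ XW ∈ bad, ∀ x ∈ XW.1, (#(A S XW.2 x) : ℝ) < θ) _
    (fun S T => ∃ w ∈ sep S, Disjoint (A S w.1 w.2.1 ∩ A S w.1 w.2.2) T) ?_ ?_).trans ?_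
  · intro S T hST
    by_contra! h
    obtain ⟨⟨h1, h2⟩, h3⟩ := h
    refine hST ?_
    refine isConnecting_of_grow hD0 rfl (by positivity) hQl (N := N) (θ := θ) ?_ ?_ ?_ ?_
    · have h4 : l ^ 6 = l * l ^ 5 := by ring
      rw [← hndef, ← hl, h4]
      have h5 : 2 * l ^ 5 ≤ l * l ^ 5 := by
        gcongr
        exact le_trans (by norm_num) hl2
      linarith
    · intro v
      rw [hDQ]
      exact h1 v (mem_univ v)
    · intro X W hX hXQ hWQ
      exact h2 (X, W) (by
        rw [hbad, Finset.mem_filter]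
        exact ⟨mem_univ _, hX, hXQ, hWQ⟩)
    · intro W hW x y hx hy
      have h4 := h3 (W, x, y) (by
        rw [hsep, Finset.mem_filter]
        exact ⟨mem_univ _, hW, hx, hy⟩)
      obtain ⟨z, hz, hzT⟩ := Finset.not_disjoint_iff.1 h4
      exact ⟨z, hzT, Finset.mem_inter.1 hz⟩
  · intro S _
    refine (bernProb_exists_le hq0 hq1 _ _).trans ?_
    have hterm : ∀ w ∈ sep S, bernProb q (fun T => Disjoint (A S w.1 w.2.1 ∩ A S w.1 w.2.2) T) ≤
        ((n : ℝ) ^ 2)⁻¹ ^ 2 * ((n : ℝ) ^ 2)⁻¹ ^ #w.1 := by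
      rintro ⟨W, x, y⟩ hw
      rw [hsep, Finset.mem_filter] at hw
      obtain ⟨-, hW, hx, hy⟩ := hw
      simp only at hW hx hy ⊢
      have h2 : (n : ℝ) / 5 ≤ #(A S W x ∩ A S W y) := by
        have h3 := Finset.card_union_add_card_inter (A S W x) (A S W y)
        have h4 := Finset.card_le_univ (A S W x ∪ A S W y)
        have h5 : (#(A S W x ∪ A S W y) : ℝ) + #(A S W x ∩ A S W y) =
          #(A S W x) + #(A S W y) := by exact_mod_cast h3
        have h6 : (#(A S W x ∪ A S W y) : ℝ) ≤ n := by exact_mod_cast h4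
        linarith
      exact bernProb_disjoint_le hl hl2 (by omega) hp0 hq0 hq1 hpq hpQ hpn hW h2
    refine (Finset.sum_le_sum hterm).trans ?_
    refine (Finset.sum_le_univ_sum_of_nonneg (fun w => by positivity)).trans ?_
    rw [← Finset.mul_sum, Fintype.sum_prod_type]
    simp only [Finset.sum_const, Finset.card_univ, Fintype.card_prod, nsmul_eq_mul,
      ← Finset.mul_sum]
    rw [← hndef]
    calc ((n : ℝ) ^ 2)⁻¹ ^ 2 * (((n * n : ℕ) : ℝ) * ∑ W : Finset V, ((n : ℝ) ^ 2)⁻¹ ^ #W)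
        ≤ ((n : ℝ) ^ 2)⁻¹ ^ 2 * (((n * n : ℕ) : ℝ) * 3) := by gcongr
      _ = 3 / (n : ℝ) ^ 2 := by push_cast; field_simp
  · have hdeg : bernProb a (fun S => ∃ v ∈ (univ : Finset V),
        (#(G.neighborFinset v ∩ S) : ℝ) < p * G.minDegree / 8) ≤ 1 / n := by
      refine (bernProb_exists_le ha0 ha1 _ _).trans ?_
      have hterm : ∀ v ∈ (univ : Finset V), bernProb a (fun S =>
          (#(G.neighborFinset v ∩ S) : ℝ) < p * G.minDegree / 8) ≤ ((n : ℝ) ^ 2)⁻¹ := by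
        intro v _
        refine (bernProb_card_inter_lt_le ha0 ha1 _).trans ?_
        rw [hexp, G.card_neighborFinset_eq_degree]
        refine Real.exp_le_exp.2 ?_
        have h1 : (G.minDegree : ℝ) ≤ G.degree v := by exact_mod_cast G.minDegree_le_degree v
        have h2 : p / 4 * G.minDegree ≤ a / 2 * G.degree v := by
          gcongr ?_ * ?_
          linarith
        linarith
      refine (Finset.sum_le_sum hterm).trans ?_
      rw [Finset.sum_const, Finset.card_univ, nsmul_eq_mul, ← hndef]
      refine le_of_eq ?_
      field_simp
    have hgr : bernProb a (fun S => ∃ XW ∈ bad, ∀ x ∈ XW.1, (#(A S XW.2 x) : ℝ) < θ) ≤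
        9 / n ^ 2 := by
      refine (bernProb_exists_le ha0 ha1 _ _).trans ?_
      have hterm : ∀ XW ∈ bad, bernProb a (fun S => ∀ x ∈ XW.1, (#(A S XW.2 x) : ℝ) < θ) ≤
          ((n : ℝ) ^ 2)⁻¹ * (((n : ℝ) ^ 2)⁻¹ ^ #XW.1 * ((n : ℝ) ^ 2)⁻¹ ^ #XW.2) := by
        rintro ⟨X, W⟩ hXW
        rw [hbad, Finset.mem_filter] at hXW
        obtain ⟨-, hX, hXQ, hWQ⟩ := hXW
        exact hG.bernProb_forall_neighbors_lt_le hε hε1 hl hl2 hn hp0 hp1 hq1 hpq hs hL1 hJ1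
          (by linarith) hQ hX hXQ hWQ
      refine (Finset.sum_le_sum hterm).trans ?_
      refine (Finset.sum_le_univ_sum_of_nonneg (fun w => by positivity)).trans ?_
      rw [← Finset.mul_sum, Fintype.sum_prod_type]
      simp only [← Finset.mul_sum, ← Finset.sum_mul]
      have h0 : 0 ≤ ∑ W : Finset V, ((n : ℝ) ^ 2)⁻¹ ^ #W :=
        Finset.sum_nonneg fun _ _ => by positivity
      calc ((n : ℝ) ^ 2)⁻¹ * ((∑ X : Finset V, ((n : ℝ) ^ 2)⁻¹ ^ #X) *
            ∑ W : Finset V, ((n : ℝ) ^ 2)⁻¹ ^ #W) ≤ ((n : ℝ) ^ 2)⁻¹ * (3 * 3) := by gcongr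
        _ = 9 / n ^ 2 := by ring
    have h1 := (bernProb_or_le ha0 ha1 _ _).trans (add_le_add hdeg hgr)
    have h2 : 12 / (n : ℝ) ^ 2 ≤ 12 / n := by
      gcongr
      exact le_self_pow₀ (by linarith) (by norm_num)
    have h3 : 9 / (n : ℝ) ^ 2 + 3 / n ^ 2 = 12 / n ^ 2 := by ring
    have h4 : 1 / (n : ℝ) + 12 / n = 13 / n := by ring
    linarith

end Connecting

end SublinearExpander

theorem mainTheorem4 :
    ∃ f : ℕ → ℝ, Filter.Tendsto f Filter.atTop (nhds 0) ∧
      ∀ (V : Type*) [Fintype V] (G : SimpleGraph V) [DecidableRel G.Adj]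
        (ε s : ℝ) (p : unitInterval),
        SublinearExpander.IsExpander G ε s →
        (2 : ℝ)⁻¹ ^ 90 < ε → ε < 1 →
        100 * Real.logb 2 (Fintype.card V : ℝ) / (G.minDegree : ℝ) ≤ (p : ℝ) →
        ((p : ℝ) ^ 4)⁻¹ * (Real.logb 2 (Fintype.card V : ℝ)) ^ 30 ≤ s →
        1 - f (Fintype.card V) ≤
          (ProbabilityTheory.setBernoulli (Set.univ : Set V) p).real
            {S : Set V | SublinearExpander.IsConnecting G
              ((p : ℝ) ^ 9 * s * (G.minDegree : ℝ) /
                ((G.maxDegree : ℝ) * (Real.logb 2 (Fintype.card V : ℝ)) ^ 73)) S} := by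
  -- For small `n` the value 1 makes the claim trivial; in the other case the failure bound is `1/n
  -- + 9/n² + 3/n² ≤ 13/n`.
  refine ⟨fun n => if 2 ^ 200 ≤ Real.logb 2 (n : ℝ) then 13 / (n : ℝ) else 1, ?_, ?_⟩
  · refine (tendsto_const_div_atTop_nhds_zero_nat (13 : ℝ)).congr' ?_
    have h := ((Real.tendsto_logb_atTop (b := 2) (by norm_num)).comp
      tendsto_natCast_atTop_atTop).eventually_ge_atTop ((2 : ℝ) ^ 200)
    filter_upwards [h] with n hn
    rw [if_pos]
    exact hn
  · intro V _ G _ ε s p hG hε hε1 hδ hs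
    classical
    dsimp only
    split_ifs with hl
    · have h1 := hG.bernProb_not_isConnecting_le hε hε1 p.2.1 p.2.2 hl hδ hs
      rw [SublinearExpander.bernProb_not] at h1
      rw [SublinearExpander.setBernoulli_real_eq_bernProb]
      linarith
    · rw [sub_self]
      exact MeasureTheory.measureReal_nonneg
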